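/- \textbf{Definitions.} A \emph{skew algebra} is an algebra $(A,0,\land,\lor,\setminus,\cap)$ such that: $\land,\lor$ are idempotent and associative and satisfy $x\land(x\lor y)=x=(y\lor x)\land x$ and $x\lor(x\land y)=x=(y\land x)\lor x$; $\land$ distributes over $\lor$ on both sides; $0$ is neutral for $\lor$; $(x\setminus y)\land(x\land y\land x)=0$ and $(x\setminus y)\lor(x\land y\land x)=x$; and $x\cap y$ is the greatest lower bound of $x,y$ for the \emph{natural partial order} $x\le y\iff x\land y=y\land x=x$. The \emph{natural preorder} is $x\preceq y\iff x\land y\land x=x$. Homomorphisms preserve $0,\land,\lor,\setminus,\cap$. A skew algebra is \emph{right-handed} if $x\land y\land x=y\land x$ identically. A \emph{$\le$-ideal} is a subset closed under finite joins (so containing $0$) and downward closed for $\le$; $\langle S\rangle_{\le}$ denotes the least $\le$-ideal containing $S$. A \emph{Boolean space} is a locally compact zero-dimensional Hausdorff space. A \emph{skew Boolean space} is a surjective étale map (local homeomorphism) $p:E\to B$ between Boolean spaces. A \emph{morphism} $(g,h)$ from $p:E\to B$ to $p':E'\to B'$ consists of continuous partial maps $g:E\rightharpoonup E'$ and $h:B\rightharpoonup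 B'$ with open domains, which are proper (preimages of compact sets are compact), such that $p(\operatorname{dom} g)\subseteq\operatorname{dom} h$, $p'(g(x))=h(p(x))$ for $x\in\operatorname{dom} g$, and for each $b\in\operatorname{dom} h$ the map $g$ restricts to a bijection from $p^{-1}(b)\cap\operatorname{dom} g$ onto $p'^{-1}(h(b))$. It is \emph{saturated} if $\operatorname{dom} g=p^{-1}(\operatorname{dom} h)$. For a skew Boolean space $p:E\to B$ let $\mathcal A(p)$ be the right-handed skew algebra of compact open sets $S\subseteq E$ on which $p$ is injective, with, writing $\sigma_p(S)=p^{-1}(p(S))$, $0=\emptyset$, $S\land R=\sigma_p(S)\cap R$, $S\lor R=S\cup(R\setminus\sigma_p(S))$, $S\setminus R=S\setminus\sigma_p(R)$ (set difference), and $\cap$ the set intersection; put $\mathcal A(g,h)(S)=g^{-1}(S)$. A \emph{prime ideal} of $A$ is a proper subset $P\ni 0$ that is closed under $\lor$, downward closed for $\preceq$, and such that $a\land b\in P$ implies $a\in P$ or $b\in P$; let $\theta_P$ be the least congruence on $A$ whose zero-class contains $P$. For a right-handed skew algebra $A$, let $\mathcal S(A)$ be the map $(P,[t])\mapsto P$ from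 the space of pairs consisting of a prime ideal $P$ and a $\theta_P$-class $[t]$ with $t\notin P$, topologized by the basic open sets $\{(P,[a])\mid a\notin P\}$ ($a\in A$), to the space of prime ideals, topologized by the basic open sets $\{P\mid a\notin P\}$ ($a\in A$). For a homomorphism $f:A\to A'$ let $\mathcal S(f):\mathcal S(A')\to\mathcal S(A)$ be the pair of partial maps $(P,[f(a)])\mapsto(f^{-1}(P),[a])$, defined for $f(a)\notin P$, and $P\mapsto f^{-1}(P)$, defined when $f^{-1}(P)\ne A$. \textbf{Theorem.} The contravariant functors $\mathcal A$ and $\mathcal S$ form a duality between the category of skew Boolean spaces with their morphisms and the category of right-handed skew algebras with homomorphisms, and they restrict to a duality between (i) the category of skew Boolean spaces and saturated morphisms, and (ii) the category of right-handed skew algebras and those homomorphisms $f:A\to A'$ for which $\langle f(A)\rangle_{\le}$ is closed under the natural preorder, i.e. $x\preceq y\in\langle f(A)\rangle_{\le}$ implies $x\in\langle f(A)\rangle_{\le}$. Moreover, a morphism $(g,h)$ of skew Boolean spaces is saturated if and only if the homomorphism $\mathcal A(g,h)$ has the property in (ii), and a homomorphism $f$ of right-handed skew algebras has the property in (ii)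 if and only if the morphism $\mathcal S(f)$ is saturated. -/

import Mathlib

open CategoryTheory Opposite

universe u

namespace SkewDuality

/-! ### Skew Boolean intersection algebras -/

/-- Operations and axioms of a skew Boolean algebra with intersections: `meet`, `join` are the
skew lattice operations, `diff` is the relative complement and `inter` is the intersection, i.e.
the greatest lower bound for the natural partial order
(`x ≤ y` iff `x ∧ y = x` and `y ∧ x = x`). -/
class SkewAlgebra (A : Type u) where
  meet : A → A → A
  join : A → A → A
  diff : A → A → A
  inter : A → A → A
  zero : A
  meet_self : ∀ x, meet x x = x
  join_self : ∀ x, join x x = x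
  meet_assoc : ∀ x y z, meet (meet x y) z = meet x (meet y z)
  join_assoc : ∀ x y z, join (join x y) z = join x (join y z)
  meet_join_absorb : ∀ x y, meet x (join x y) = x
  join_meet_absorb' : ∀ x y, meet (join y x) x = x
  join_meet_absorb : ∀ x y, join x (meet x y) = x
  meet_join_absorb' : ∀ x y, join (meet y x) x = x
  meet_distrib_left : ∀ x y z, meet x (join y z) = join (meet x y) (meet x z)
  meet_distrib_right : ∀ x y z, meet (join y z) x = join (meet y x) (meet z x)
  zero_join : ∀ x, join zero x = x
  join_zero : ∀ x, join x zero = x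
  diff_meet : ∀ x y, meet (diff x y) (meet (meet x y) x) = zero
  diff_join : ∀ x y, join (diff x y) (meet (meet x y) x) = x
  inter_le_left : ∀ x y, meet (inter x y) x = inter x y ∧ meet x (inter x y) = inter x y
  inter_le_right : ∀ x y, meet (inter x y) y = inter x y ∧ meet y (inter x y) = inter x y
  le_inter : ∀ x y z, (meet z x = z ∧ meet x z = z) → (meet z y = z ∧ meet y z = z) →
    (meet z (inter x y) = z ∧ meet (inter x y) z = z)

infixl:70 " ⋏ " => SkewAlgebra.meet
infixl:65 " ⋎ " => SkewAlgebra.join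

open SkewAlgebra

/-- The natural partial order. -/
def NatLE {A : Type u} [SkewAlgebra A] (x y : A) : Prop := x ⋏ y = x ∧ y ⋏ x = x

/-- The natural preorder. -/
def NatPre {A : Type u} [SkewAlgebra A] (x y : A) : Prop := x ⋏ y ⋏ x = x

/-- Right-handedness. -/
def RightHanded (A : Type u) [SkewAlgebra A] : Prop := ∀ x y : A, x ⋏ y ⋏ x = y ⋏ x

/-- A subset closed under finite joins (including the empty one) and downward closed for the
natural partial order. -/
structure IsLEIdeal {A : Type u} [SkewAlgebra A] (I : Set A) : Prop where
  zero_mem : (zero : A) ∈ I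
  join_mem : ∀ x y, x ∈ I → y ∈ I → x ⋎ y ∈ I
  lower : ∀ x y, NatLE x y → y ∈ I → x ∈ I

/-- The `≤`-ideal generated by a subset. -/
def leIdeal {A : Type u} [SkewAlgebra A] (S : Set A) : Set A :=
  ⋂₀ {I | IsLEIdeal I ∧ S ⊆ I}

/-- Being a lower set for the natural preorder. -/
def PreClosed {A : Type u} [SkewAlgebra A] (I : Set A) : Prop :=
  ∀ x y, NatPre x y → y ∈ I → x ∈ I

/-- Homomorphisms preserve all the operations. -/
@[ext]
structure SkewHom (A B : Type u) [SkewAlgebra A] [SkewAlgebra B] where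
  toFun : A → B
  map_zero : toFun zero = zero
  map_meet : ∀ x y, toFun (x ⋏ y) = toFun x ⋏ toFun y
  map_join : ∀ x y, toFun (x ⋎ y) = toFun x ⋎ toFun y
  map_diff : ∀ x y, toFun (diff x y) = diff (toFun x) (toFun y)
  map_inter : ∀ x y, toFun (inter x y) = inter (toFun x) (toFun y)

/-- The category of right-handed skew Boolean algebras with intersections. -/
structure RSkewAlg : Type (u + 1) where
  carrier : Type u
  [str : SkewAlgebra carrier]
  rightHanded : RightHanded carrier

attribute [instance] RSkewAlg.str

instance : Category RSkewAlg.{u} where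
  Hom A B := SkewHom A.carrier B.carrier
  id A := ⟨fun x => x, rfl, fun _ _ => rfl, fun _ _ => rfl, fun _ _ => rfl, fun _ _ => rfl⟩
  comp f g :=
    { toFun := fun x => g.toFun (f.toFun x)
      map_zero := by rw [f.map_zero, g.map_zero]
      map_meet := fun x y => by rw [f.map_meet, g.map_meet]
      map_join := fun x y => by rw [f.map_join, g.map_join]
      map_diff := fun x y => by rw [f.map_diff, g.map_diff]
      map_inter := fun x y => by rw [f.map_inter, g.map_inter] }

/-! ### Elementary facts about right-handed algebras -/

section Algebra

variable {A : Type u} [SkewAlgebra A]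

theorem zero_meet (x : A) : zero ⋏ x = (zero : A) := by
  have h := meet_join_absorb (zero : A) x
  rwa [zero_join] at h

theorem meet_zero (x : A) : x ⋏ zero = (zero : A) := by
  have h := join_meet_absorb' (zero : A) x
  rwa [join_zero] at h

theorem natLE_refl (x : A) : NatLE x x := ⟨meet_self x, meet_self x⟩

theorem natLE_trans {x y z : A} (h : NatLE x y) (k : NatLE y z) : NatLE x z := by
  refine ⟨?_, ?_⟩
  · rw [← h.1, meet_assoc, k.1]
  · rw [← h.2, ← meet_assoc, k.2]

theorem inter_natLE_left (x y : A) : NatLE (inter x y) x := inter_le_left x y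

theorem inter_natLE_right (x y : A) : NatLE (inter x y) y := inter_le_right x y

theorem natLE_inter {x y z : A} (h : NatLE z x) (k : NatLE z y) : NatLE z (inter x y) :=
  le_inter x y z h k

theorem meet_natPre_left (x y : A) : NatPre (x ⋏ y) x := by
  unfold NatPre
  rw [meet_assoc (x ⋏ y), ← meet_assoc x x y, meet_self, meet_self]

theorem meet_natPre_right (x y : A) : NatPre (x ⋏ y) y := by
  unfold NatPre
  rw [meet_assoc x y y, meet_self, meet_self]

theorem natPre_join_left (x y : A) : NatPre x (x ⋎ y) := by
  unfold NatPre
  rw [meet_join_absorb, meet_self]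

theorem natPre_join_right (x y : A) : NatPre y (x ⋎ y) := by
  unfold NatPre
  rw [meet_assoc, join_meet_absorb', meet_self]

theorem natPre_of_natLE {x y : A} (h : NatLE x y) : NatPre x y := by
  unfold NatPre
  rw [h.1, meet_self]

theorem natPre_iff (hA : RightHanded A) {x y : A} : NatPre x y ↔ y ⋏ x = x := by
  unfold NatPre
  rw [hA]

theorem rh_diff_meet (hA : RightHanded A) (x y : A) : diff x y ⋏ (y ⋏ x) = zero := by
  rw [← hA x y]; exact diff_meet x y

theorem rh_diff_join (hA : RightHanded A) (x y : A) : diff x y ⋎ (y ⋏ x) = x := by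
  rw [← hA x y]; exact diff_join x y

theorem diff_natLE (hA : RightHanded A) (x y : A) : NatLE (diff x y) x := by
  have e := meet_join_absorb (diff x y) (y ⋏ x)
  rw [rh_diff_join hA] at e
  refine ⟨e, ?_⟩
  rw [← hA, e, meet_self]

theorem diff_meet_zero (hA : RightHanded A) (x y : A) : diff x y ⋏ y = zero := by
  have h : diff x y ⋏ (x ⋏ y) = zero := by
    rw [← hA y x, ← meet_assoc, rh_diff_meet hA, zero_meet]
  rw [← (diff_natLE hA x y).1, meet_assoc, h]

theorem meet_diff_zero (hA : RightHanded A) (x y : A) : y ⋏ diff x y = zero := by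
  rw [← hA, diff_meet_zero hA, zero_meet]

/-- Equivalent elements below a common element coincide. -/
theorem eq_of_below (hA : RightHanded A) {a b x : A} (ha : NatLE a x) (hb : NatLE b x)
    (h1 : a ⋏ b = b)
    (h3 : b ⋏ a = a) : a = b := by
  have e : diff x a ⋎ a = x := by
    have h := rh_diff_join hA x a
    rwa [ha.1] at h
  have hz : b ⋏ diff x a = zero := by
    rw [← hA, ← h1, ← meet_assoc, diff_meet_zero hA, zero_meet, zero_meet]
  have h2 : b ⋏ x = b := hb.1
  rw [← e, meet_distrib_left, hz, zero_join] at h2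
  rw [← h3, h2]

theorem meet_right_natLE (hA : RightHanded A) (x w : A) : NatLE (x ⋏ w) w := by
  refine ⟨?_, ?_⟩
  · rw [meet_assoc, meet_self]
  · rw [← meet_assoc, hA]

theorem meet_normal (hA : RightHanded A) (x y w : A) : x ⋏ y ⋏ w = y ⋏ x ⋏ w := by
  have key : ∀ x y : A, (x ⋏ y ⋏ w) ⋏ (y ⋏ x ⋏ w) = y ⋏ x ⋏ w := by
    intro x y
    have h : w ⋏ (y ⋏ x ⋏ w) = y ⋏ x ⋏ w := (meet_right_natLE hA (y ⋏ x) w).2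
    rw [meet_assoc (x ⋏ y), h, meet_assoc y x w, meet_assoc x y, ← meet_assoc y y, meet_self,
      ← meet_assoc, ← meet_assoc, hA, meet_assoc]
  exact eq_of_below hA (meet_right_natLE hA _ w) (meet_right_natLE hA _ w) (key x y) (key y x)

theorem meet_natLE_meet (hA : RightHanded A) {a b x u : A} (h : NatLE a x) (k : NatLE b u) :
    NatLE (a ⋏ b) (x ⋏ u) := by
  refine ⟨?_, ?_⟩
  · rw [← meet_assoc, meet_assoc a b x, meet_assoc a (b ⋏ x) u, meet_normal hA b x u,
      meet_assoc x b u, k.1, ← meet_assoc, h.1]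
  · rw [← meet_assoc, meet_assoc x u a, meet_assoc x (u ⋏ a) b, meet_normal hA u a b,
      meet_assoc a u b, k.2, ← meet_assoc, h.2]

/-- The meet of two elements below a common element is a lower bound of both. -/
theorem meet_natLE_left (hA : RightHanded A) {a b x : A} (h : NatLE a x) (k : NatLE b x) :
    NatLE (a ⋏ b) a := by
  refine ⟨?_, ?_⟩
  · have h1 := meet_normal hA b a x
    rw [meet_assoc, h.1, meet_assoc, k.1] at h1
    rw [hA, h1]
  · rw [← meet_assoc, meet_self]

theorem natLE_join_left (hA : RightHanded A) (x y : A) : NatLE x (x ⋎ y) := by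
  refine ⟨meet_join_absorb x y, ?_⟩
  rw [← hA, meet_join_absorb, meet_self]

theorem natPre_join (hA : RightHanded A) {c d a b : A} (h : NatPre c a) (k : NatPre d b) :
    NatPre (c ⋎ d) (a ⋎ b) := by
  rw [natPre_iff hA] at *
  have h1 : (a ⋎ b) ⋏ c = c := by
    rw [← h, ← meet_assoc, (natLE_join_left hA a b).2]
  have h2 : (a ⋎ b) ⋏ d = d := by
    rw [← k, ← meet_assoc, join_meet_absorb']
  rw [meet_distrib_left, h1, h2]

theorem natPre_trans (hA : RightHanded A) {x y z : A} (h : NatPre x y) (k : NatPre y z) :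
    NatPre x z := by
  rw [natPre_iff hA] at *
  rw [← h, ← meet_assoc, k]

/-- The part of `w` outside `s`, in a join one of whose terms lies over `w` and the other one
under `s`. -/
theorem diff_natLE_join (hA : RightHanded A) {w s x u : A} (hw : NatLE w u) (hx : NatPre x s) :
    NatLE (diff w s) (x ⋎ u) := by
  have hu := natLE_trans (diff_natLE hA w s) hw
  have hx' := (natPre_iff hA).1 hx
  have h1 : diff w s ⋏ x = zero := by
    rw [← hx', ← meet_assoc, diff_meet_zero hA, zero_meet]
  have h2 : x ⋏ diff w s = zero := by
    rw [← hA, h1, zero_meet]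
  refine ⟨?_, ?_⟩
  · rw [meet_distrib_left, h1, zero_join, hu.1]
  · rw [meet_distrib_right, h2, zero_join, hu.2]

theorem diff_natLE_diff (hA : RightHanded A) {z s x u : A} (hz : NatLE z x) (hu : NatPre u s) :
    NatLE (diff z s) (diff x u) := by
  have hx := natLE_trans (diff_natLE hA z s) hz
  have hu' := (natPre_iff hA).1 hu
  have h1 : diff z s ⋏ u = zero := by
    rw [← hu', ← meet_assoc, diff_meet_zero hA, zero_meet]
  have h2 : u ⋏ diff z s = zero := by
    rw [← hA, h1, zero_meet]
  have e := rh_diff_join hA x u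
  refine ⟨?_, ?_⟩
  · have h3 := hx.1
    rw [← e, meet_distrib_left, ← meet_assoc (diff z s) u x, h1, zero_meet, join_zero] at h3
    exact h3
  · have h3 := hx.2
    rw [← e, meet_distrib_right, meet_assoc u x, hx.2, h2, join_zero] at h3
    exact h3

theorem isLEIdeal_leIdeal (S : Set A) : IsLEIdeal (leIdeal S) where
  zero_mem := fun _ hI => hI.1.zero_mem
  join_mem := fun x y hx hy I hI => hI.1.join_mem x y (hx I hI) (hy I hI)
  lower := fun x y h hy I hI => hI.1.lower x y h (hy I hI)

theorem subset_leIdeal (S : Set A) : S ⊆ leIdeal S := fun _ hx _ hI => hI.2 hx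

theorem leIdeal_subset {S I : Set A} (hI : IsLEIdeal I) (h : S ⊆ I) : leIdeal S ⊆ I :=
  fun _ hx => hx I ⟨hI, h⟩

end Algebra

/-- The homomorphisms for which the `≤`-ideal generated by the image is closed under the natural
preorder. -/
def preClosedImage : MorphismProperty RSkewAlg.{u} :=
  fun _ _ f => PreClosed (leIdeal (Set.range (SkewHom.toFun f)))

instance : preClosedImage.{u}.IsMultiplicative where
  id_mem X := by
    intro x y _ _
    exact subset_leIdeal _ ⟨x, rfl⟩
  comp_mem {X Y Z} f g hf hg := by
    have hZ := Z.rightHanded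
    intro x y hxy hy
    set S : Set Z.carrier := Set.range (SkewHom.toFun (f ≫ g)) with hS
    have hSm : ∀ a, g.toFun (f.toFun a) ∈ leIdeal S := fun a => subset_leIdeal S ⟨a, rfl⟩
    have hI := isLEIdeal_leIdeal S
    have hyg : y ∈ leIdeal (Set.range g.toFun) := by
      refine leIdeal_subset (isLEIdeal_leIdeal _) ?_ hy
      rintro _ ⟨a, rfl⟩
      exact subset_leIdeal _ ⟨f.toFun a, rfl⟩
    have hxg := hg x y hxy hyg
    obtain ⟨a, ha⟩ : ∃ a, NatPre y (g.toFun (f.toFun a)) := by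
      have hJ : IsLEIdeal {c : Z.carrier | ∃ a, NatPre c (g.toFun (f.toFun a))} := by
        refine ⟨⟨zero, ?_⟩, ?_, ?_⟩
        · unfold NatPre
          rw [zero_meet, zero_meet]
        · rintro c d ⟨a, ha⟩ ⟨b, hb⟩
          refine ⟨a ⋎ b, ?_⟩
          rw [f.map_join, g.map_join]
          exact natPre_join hZ ha hb
        · rintro c d h ⟨a, ha⟩
          exact ⟨a, natPre_trans hZ (natPre_of_natLE h) ha⟩
      refine leIdeal_subset hJ ?_ hy
      rintro _ ⟨a, rfl⟩
      exact ⟨a, natPre_of_natLE (natLE_refl (g.toFun (f.toFun a)))⟩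
    have hxa := (natPre_iff hZ).1 (natPre_trans hZ hxy ha)
    rw [← hxa]
    have hJ : IsLEIdeal {c : Z.carrier | g.toFun (f.toFun a) ⋏ c ∈ leIdeal S} := by
      refine ⟨?_, ?_, ?_⟩
      · change g.toFun (f.toFun a) ⋏ _ ∈ leIdeal S
        rw [meet_zero]
        exact hI.zero_mem
      · intro c d hc hd
        change g.toFun (f.toFun a) ⋏ _ ∈ leIdeal S
        rw [meet_distrib_left]
        exact hI.join_mem _ _ hc hd
      · intro c d h hd
        exact hI.lower _ _ (meet_natLE_meet hZ (natLE_refl _) h) hd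
    refine leIdeal_subset hJ ?_ hxg
    rintro _ ⟨b, rfl⟩
    change g.toFun (f.toFun a) ⋏ _ ∈ leIdeal S
    rw [← g.map_meet]
    have hb : f.toFun a ⋏ b ∈ leIdeal (Set.range f.toFun) :=
      hf _ _ (meet_natPre_left _ _) (subset_leIdeal _ ⟨a, rfl⟩)
    have hK : IsLEIdeal {c : Y.carrier | g.toFun c ∈ leIdeal S} := by
      refine ⟨?_, ?_, ?_⟩
      · change g.toFun _ ∈ leIdeal S
        rw [g.map_zero]
        exact hI.zero_mem
      · intro c d hc hd
        change g.toFun _ ∈ leIdeal S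
        rw [g.map_join]
        exact hI.join_mem _ _ hc hd
      · intro c d h hd
        refine hI.lower _ (g.toFun d) ⟨?_, ?_⟩ hd
        · rw [← g.map_meet, h.1]
        · rw [← g.map_meet, h.2]
    refine leIdeal_subset hK ?_ hb
    rintro _ ⟨c, rfl⟩
    exact hSm c

/-! ### Skew Boolean spaces -/

/-- A Boolean space: Hausdorff, locally compact and zero-dimensional. -/
structure IsBooleanSpace (X : Type u) [TopologicalSpace X] : Prop where
  t2 : T2Space X
  locallyCompact : LocallyCompactSpace X
  zeroDim : TopologicalSpace.IsTopologicalBasis {s : Set X | IsClopen s}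

/-- A skew Boolean space: a surjective étale map between Boolean spaces. -/
structure SkewBoolSp : Type (u + 1) where
  total : Type u
  base : Type u
  [topTotal : TopologicalSpace total]
  [topBase : TopologicalSpace base]
  proj : total → base
  booleanTotal : IsBooleanSpace total
  booleanBase : IsBooleanSpace base
  etale : IsLocalHomeomorph proj
  surj : Function.Surjective proj

attribute [instance] SkewBoolSp.topTotal SkewBoolSp.topBase

/-- A proper continuous partial map with open domain of definition. -/
structure IsProperPartial {X Y : Type u} [TopologicalSpace X] [TopologicalSpace Y]
    (f : X →. Y) : Prop where
  isOpen_dom : IsOpen f.Dom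
  continuous : Continuous (fun x : f.Dom => f.fn x.1 x.2)
  proper : ∀ K : Set Y, IsCompact K → IsCompact (f.preimage K)

/-- A morphism of skew Boolean spaces: a pair of proper continuous partial maps with open domains
forming a commutative square (wherever `g` is defined, so is `h` below it, and the two composites
agree there), such that `g` restricts for each `b ∈ dom h` to a bijection from the part of the
fibre over `b` lying in `dom g` onto the fibre over `h b`. -/
@[ext]
structure SkewBoolHom (p q : SkewBoolSp.{u}) where
  g : p.total →. q.total
  h : p.base →. q.base
  proper_g : IsProperPartial g
  proper_h : IsProperPartial h
  comm : ∀ x y, y ∈ g x → q.proj y ∈ h (p.proj x)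
  fiber : ∀ b c, c ∈ h b → ∀ y, q.proj y = c → ∃! x, p.proj x = b ∧ y ∈ g x

section Partial

variable {X Y Z : Type u} [TopologicalSpace X] [TopologicalSpace Y] [TopologicalSpace Z]

theorem isProperPartial_iff {f : X →. Y} : IsProperPartial f ↔
    (∀ s, IsOpen s → IsOpen (f.preimage s)) ∧ ∀ K, IsCompact K → IsCompact (f.preimage K) := by
  have key : ∀ s, f.preimage s
      = Subtype.val '' ((fun x : f.Dom => f.fn x.1 x.2) ⁻¹' s) := by
    intro s
    ext x
    constructor
    · rintro ⟨y, hy, hxy⟩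
      obtain ⟨hx, rfl⟩ := hxy
      exact ⟨⟨x, hx⟩, hy, rfl⟩
    · rintro ⟨⟨x, hx⟩, hy, rfl⟩
      exact ⟨_, hy, Part.get_mem hx⟩
  constructor
  · rintro ⟨h1, h2, h3⟩
    refine ⟨fun s hs => ?_, h3⟩
    rw [key]
    exact h1.isOpenMap_subtype_val _ (hs.preimage h2)
  · rintro ⟨h1, h2⟩
    have hd : IsOpen f.Dom := by
      rw [← PFun.preimage_univ]
      exact h1 _ isOpen_univ
    refine ⟨hd, ⟨fun s hs => ?_⟩, h2⟩
    have := (h1 s hs).preimage (continuous_subtype_val (p := fun x => x ∈ f.Dom))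
    rwa [key, Set.preimage_image_eq _ Subtype.val_injective] at this

theorem isProperPartial_id : IsProperPartial (PFun.id X) := by
  have key : ∀ s, (PFun.id X).preimage s = s := by
    intro s
    rw [← PFun.coe_id, PFun.coe_preimage]
    rfl
  rw [isProperPartial_iff]
  exact ⟨fun s hs => by rwa [key], fun s hs => by rwa [key]⟩

theorem isProperPartial_comp {f : X →. Y} {g : Y →. Z} (hf : IsProperPartial f)
    (hg : IsProperPartial g) : IsProperPartial (g.comp f) := by
  rw [isProperPartial_iff] at *
  refine ⟨fun s hs => ?_, fun s hs => ?_⟩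
  · rw [PFun.preimage_comp]
    exact hf.1 _ (hg.1 _ hs)
  · rw [PFun.preimage_comp]
    exact hf.2 _ (hg.2 _ hs)

end Partial

theorem mem_comp_iff {X Y Z : Type u} (f : X →. Y) (g : Y →. Z) (x : X) (z : Z) :
    z ∈ g.comp f x ↔ ∃ y, y ∈ f x ∧ z ∈ g y := by
  rw [PFun.comp_apply]
  exact Part.mem_bind_iff

theorem mem_id_iff {X : Type u} (x y : X) : y ∈ PFun.id X x ↔ y = x := by
  rw [PFun.id_apply, Part.mem_some_iff]

instance : Category SkewBoolSp.{u} where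
  Hom p q := SkewBoolHom p q
  id p :=
    { g := PFun.id _
      h := PFun.id _
      proper_g := isProperPartial_id
      proper_h := isProperPartial_id
      comm := by
        intro x y hy
        rw [mem_id_iff] at *
        rw [hy]
      fiber := by
        intro b c hc y hy
        rw [mem_id_iff] at hc
        refine ⟨y, ⟨hy.trans hc, (mem_id_iff _ _).2 rfl⟩, ?_⟩
        rintro x ⟨_, hx⟩
        exact ((mem_id_iff _ _).1 hx).symm }
  comp {p q r} φ ψ :=
    { g := ψ.g.comp φ.g
      h := ψ.h.comp φ.h
      proper_g := isProperPartial_comp φ.proper_g ψ.proper_g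
      proper_h := isProperPartial_comp φ.proper_h ψ.proper_h
      comm := by
        intro x z hz
        rw [mem_comp_iff] at *
        obtain ⟨y, hy, hz⟩ := hz
        exact ⟨_, φ.comm x y hy, ψ.comm y z hz⟩
      fiber := by
        intro b d hd z hz
        rw [mem_comp_iff] at hd
        obtain ⟨c, hc, hd⟩ := hd
        obtain ⟨y, ⟨hy, hyz⟩, hy'⟩ := ψ.fiber c d hd z hz
        obtain ⟨x, ⟨hx, hxy⟩, hx'⟩ := φ.fiber b c hc y hy
        refine ⟨x, ⟨hx, (mem_comp_iff _ _ _ _).2 ⟨y, hxy, hyz⟩⟩, ?_⟩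
        rintro x₁ ⟨h1, h2⟩
        obtain ⟨y₁, h3, h4⟩ := (mem_comp_iff _ _ _ _).1 h2
        have h5 : q.proj y₁ = c := by
          have := φ.comm _ _ h3
          rw [h1] at this
          exact Part.mem_unique this hc
        obtain rfl := hy' y₁ ⟨h5, h4⟩
        exact hx' x₁ ⟨h1, h3⟩ }
  id_comp φ := by
    refine SkewBoolHom.ext ?_ ?_
    · exact PFun.comp_id _
    · exact PFun.comp_id _
  comp_id φ := by
    refine SkewBoolHom.ext ?_ ?_
    · exact PFun.id_comp _
    · exact PFun.id_comp _
  assoc φ ψ χ := by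
    refine SkewBoolHom.ext ?_ ?_
    · exact (PFun.comp_assoc _ _ _).symm
    · exact (PFun.comp_assoc _ _ _).symm

/-- A morphism `(g, h) : p ⟶ q` is saturated when `dom g = p⁻¹(dom h)`. -/
def saturated : MorphismProperty SkewBoolSp.{u} :=
  fun p _ φ => (SkewBoolHom.g φ).Dom = p.proj ⁻¹' (SkewBoolHom.h φ).Dom

instance : saturated.{u}.IsMultiplicative where
  id_mem p := rfl
  comp_mem {p q r} φ ψ hφ hψ := by
    have hφ' : ∀ x, x ∈ φ.g.Dom ↔ p.proj x ∈ φ.h.Dom := fun x => Set.ext_iff.1 hφ x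
    have hψ' : ∀ x, x ∈ ψ.g.Dom ↔ q.proj x ∈ ψ.h.Dom := fun x => Set.ext_iff.1 hψ x
    change (ψ.g.comp φ.g).Dom = p.proj ⁻¹' (ψ.h.comp φ.h).Dom
    ext x
    rw [Set.mem_preimage, PFun.mem_dom, PFun.mem_dom]
    constructor
    · rintro ⟨z, hz⟩
      obtain ⟨y, hy, hz⟩ := (mem_comp_iff _ _ _ _).1 hz
      exact ⟨_, (mem_comp_iff _ _ _ _).2 ⟨_, φ.comm _ _ hy, ψ.comm _ _ hz⟩⟩
    · rintro ⟨z, hz⟩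
      obtain ⟨c, hc, hz⟩ := (mem_comp_iff _ _ _ _).1 hz
      obtain ⟨y, hy⟩ := (PFun.mem_dom _ _).1 ((hφ' x).2 ((PFun.mem_dom _ _).2 ⟨c, hc⟩))
      obtain rfl := Part.mem_unique (φ.comm _ _ hy) hc
      obtain ⟨w, hw⟩ := (PFun.mem_dom _ _).1 ((hψ' y).2 ((PFun.mem_dom _ _).2 ⟨z, hz⟩))
      exact ⟨w, (mem_comp_iff _ _ _ _).2 ⟨y, hy, hw⟩⟩

/-! ### From spaces to algebras -/

/-- A copen section of `p`, as a compact open subset of the total space that meets each fibre at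
most once. -/
@[ext]
structure CopenSection (p : SkewBoolSp.{u}) : Type u where
  carrier : Set p.total
  isCompact : IsCompact carrier
  isOpen : IsOpen carrier
  injOn : Set.InjOn p.proj carrier

/-- The saturation `p⁻¹(p(S))`. -/
def saturation (p : SkewBoolSp.{u}) (S : Set p.total) : Set p.total :=
  p.proj ⁻¹' (p.proj '' S)

section CopenSection

variable {p : SkewBoolSp.{u}}

theorem isOpen_saturation {S : Set p.total} (h : IsOpen S) : IsOpen (saturation p S) :=
  (p.etale.isOpenMap S h).preimage p.etale.continuous

theorem isClosed_saturation {S : Set p.total} (h : IsCompact S) : IsClosed (saturation p S) :=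
  haveI := p.booleanBase.t2
  (h.image p.etale.continuous).isClosed.preimage p.etale.continuous

theorem subset_saturation (S : Set p.total) : S ⊆ saturation p S := Set.subset_preimage_image _ _

theorem mem_saturation_congr {S : Set p.total} {x y : p.total} (h : p.proj x = p.proj y) :
    x ∈ saturation p S ↔ y ∈ saturation p S := by
  unfold saturation
  rw [Set.mem_preimage, Set.mem_preimage, h]

namespace CopenSection

def meet (S R : CopenSection p) : CopenSection p where
  carrier := saturation p S.carrier ∩ R.carrier
  isCompact := R.isCompact.inter_left (isClosed_saturation S.isCompact)
  isOpen := (isOpen_saturation S.isOpen).inter R.isOpen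
  injOn := R.injOn.mono Set.inter_subset_right

def join (S R : CopenSection p) : CopenSection p where
  carrier := S.carrier ∪ (R.carrier \ saturation p S.carrier)
  isCompact := S.isCompact.union (R.isCompact.diff (isOpen_saturation S.isOpen))
  isOpen := S.isOpen.union (R.isOpen.sdiff (isClosed_saturation S.isCompact))
  injOn := by
    rintro x (hx | hx) y (hy | hy) h
    · exact S.injOn hx hy h
    · exact absurd ((mem_saturation_congr h).1 (subset_saturation _ hx)) hy.2
    · exact absurd ((mem_saturation_congr h).2 (subset_saturation _ hy)) hx.2
    · exact R.injOn hx.1 hy.1 h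

def diff (S R : CopenSection p) : CopenSection p where
  carrier := S.carrier \ saturation p R.carrier
  isCompact := S.isCompact.diff (isOpen_saturation R.isOpen)
  isOpen := S.isOpen.sdiff (isClosed_saturation R.isCompact)
  injOn := S.injOn.mono Set.sdiff_subset

def inter (S R : CopenSection p) : CopenSection p where
  carrier := S.carrier ∩ R.carrier
  isCompact :=
    haveI := p.booleanTotal.t2
    S.isCompact.inter R.isCompact
  isOpen := S.isOpen.inter R.isOpen
  injOn := S.injOn.mono Set.inter_subset_left

def empty : CopenSection p where
  carrier := ∅
  isCompact := isCompact_empty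
  isOpen := isOpen_empty
  injOn := Set.injOn_empty _

theorem ext_iff' {S R : CopenSection p} : S = R ↔ ∀ x, x ∈ S.carrier ↔ x ∈ R.carrier := by
  rw [CopenSection.ext_iff, Set.ext_iff]

theorem mem_meet (S R : CopenSection p) (x : p.total) :
    x ∈ (meet S R).carrier ↔ x ∈ saturation p S.carrier ∧ x ∈ R.carrier := Iff.rfl

theorem mem_join (S R : CopenSection p) (x : p.total) :
    x ∈ (join S R).carrier ↔
      x ∈ S.carrier ∨ (x ∈ R.carrier ∧ x ∉ saturation p S.carrier) := Iff.rfl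

theorem mem_diff (S R : CopenSection p) (x : p.total) :
    x ∈ (diff S R).carrier ↔ x ∈ S.carrier ∧ x ∉ saturation p R.carrier := Iff.rfl

theorem mem_inter (S R : CopenSection p) (x : p.total) :
    x ∈ (inter S R).carrier ↔ x ∈ S.carrier ∧ x ∈ R.carrier := Iff.rfl

theorem mem_empty (x : p.total) : x ∈ (empty : CopenSection p).carrier ↔ False := Iff.rfl

theorem mem_sat_iff (S : CopenSection p) (x : p.total) :
    x ∈ saturation p S.carrier ↔ ∃ y ∈ S.carrier, p.proj y = p.proj x := Iff.rfl

theorem sat_meet (S R : CopenSection p) (x : p.total) :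
    x ∈ saturation p (meet S R).carrier ↔
      x ∈ saturation p S.carrier ∧ x ∈ saturation p R.carrier := by
  constructor
  · rintro ⟨y, ⟨hy, hy'⟩, h⟩
    exact ⟨(mem_saturation_congr h).1 hy, y, hy', h⟩
  · rintro ⟨hS, y, hy, h⟩
    exact ⟨y, ⟨(mem_saturation_congr h).2 hS, hy⟩, h⟩

theorem sat_join (S R : CopenSection p) (x : p.total) :
    x ∈ saturation p (join S R).carrier ↔
      x ∈ saturation p S.carrier ∨ x ∈ saturation p R.carrier := by
  constructor
  · rintro ⟨y, hy | hy, h⟩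
    · exact Or.inl ⟨y, hy, h⟩
    · exact Or.inr ⟨y, hy.1, h⟩
  · intro hx
    by_cases hS : x ∈ saturation p S.carrier
    · obtain ⟨y, hy, h⟩ := hS
      exact ⟨y, Or.inl hy, h⟩
    · obtain ⟨y, hy, h⟩ := hx.resolve_left hS
      exact ⟨y, Or.inr ⟨hy, fun h' => hS ((mem_saturation_congr h).1 h')⟩, h⟩

theorem sat_diff (S R : CopenSection p) (x : p.total) :
    x ∈ saturation p (diff S R).carrier ↔
      x ∈ saturation p S.carrier ∧ x ∉ saturation p R.carrier := by
  constructor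
  · rintro ⟨y, ⟨hy, hy'⟩, h⟩
    exact ⟨⟨y, hy, h⟩, fun h' => hy' ((mem_saturation_congr h).2 h')⟩
  · rintro ⟨⟨y, hy, h⟩, hR⟩
    exact ⟨y, ⟨hy, fun h' => hR ((mem_saturation_congr h).1 h')⟩, h⟩

theorem sat_of_mem {S : CopenSection p} {x : p.total} (h : x ∈ S.carrier) :
    x ∈ saturation p S.carrier := subset_saturation _ h

/-- The natural partial order of copen sections is inclusion. -/
theorem le_iff (S R : CopenSection p) :
    (meet S R = S ∧ meet R S = S) ↔ S.carrier ⊆ R.carrier := by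
  constructor
  · rintro ⟨h, -⟩ x hx
    exact ((ext_iff'.1 h x).2 hx).2
  · intro h
    refine ⟨ext_iff'.2 fun x => ⟨?_, fun hx => ⟨sat_of_mem hx, h hx⟩⟩,
      ext_iff'.2 fun x => ⟨fun hx => hx.2, fun hx => ⟨sat_of_mem (h hx), hx⟩⟩⟩
    rintro ⟨⟨y, hy, hyx⟩, hx⟩
    rwa [← R.injOn (h hy) hx hyx]

instance : SkewAlgebra (CopenSection p) where
  meet := meet
  join := join
  diff := diff
  inter := inter
  zero := empty
  meet_self S := by
    refine ext_iff'.2 fun x => ?_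
    have := @sat_of_mem p S x
    rw [mem_meet]; tauto
  join_self S := by
    refine ext_iff'.2 fun x => ?_
    have := @sat_of_mem p S x
    rw [mem_join]; tauto
  meet_assoc S R T := by
    refine ext_iff'.2 fun x => ?_
    simp only [mem_meet, sat_meet]; tauto
  join_assoc S R T := by
    refine ext_iff'.2 fun x => ?_
    simp only [mem_join, sat_join]; tauto
  meet_join_absorb S R := by
    refine ext_iff'.2 fun x => ?_
    have := @sat_of_mem p S x
    simp only [mem_meet, mem_join]; tauto
  join_meet_absorb' S R := by
    refine ext_iff'.2 fun x => ?_
    have := @sat_of_mem p S x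
    simp only [mem_meet, sat_join]; tauto
  join_meet_absorb S R := by
    refine ext_iff'.2 fun x => ?_
    simp only [mem_meet, mem_join]; tauto
  meet_join_absorb' S R := by
    refine ext_iff'.2 fun x => ?_
    have := @sat_of_mem p S x
    simp only [mem_meet, mem_join, sat_meet]; tauto
  meet_distrib_left S R T := by
    refine ext_iff'.2 fun x => ?_
    simp only [mem_meet, mem_join, sat_meet]; tauto
  meet_distrib_right S R T := by
    refine ext_iff'.2 fun x => ?_
    simp only [mem_meet, mem_join, sat_join, sat_meet]
    have := @sat_of_mem p S x
    tauto
  zero_join S := by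
    refine ext_iff'.2 fun x => ?_
    have : x ∉ saturation p (empty : CopenSection p).carrier := fun ⟨_, h, _⟩ => h
    simp only [mem_join, mem_empty]; tauto
  join_zero S := by
    refine ext_iff'.2 fun x => ?_
    simp only [mem_join, mem_empty]; tauto
  diff_meet S R := by
    refine ext_iff'.2 fun x => ?_
    simp only [mem_meet, sat_meet, sat_diff, mem_empty]; tauto
  diff_join S R := by
    refine ext_iff'.2 fun x => ?_
    have := @sat_of_mem p S x
    simp only [mem_meet, mem_join, mem_diff, sat_meet, sat_diff]; tauto
  inter_le_left S R := (le_iff _ _).2 Set.inter_subset_left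
  inter_le_right S R := (le_iff _ _).2 Set.inter_subset_right
  le_inter S R T h k := (le_iff _ _).2 (Set.subset_inter ((le_iff _ _).1 h) ((le_iff _ _).1 k))

theorem rightHanded : RightHanded (CopenSection p) := by
  intro S R
  refine ext_iff'.2 fun x => ?_
  have := @sat_of_mem p S x
  change x ∈ (meet (meet S R) S).carrier ↔ x ∈ (meet R S).carrier
  simp only [mem_meet, sat_meet]; tauto

end CopenSection

/-- The inverse image of a copen section along a morphism. -/
def pullSection {p q : SkewBoolSp.{u}} (φ : SkewBoolHom p q) (S : CopenSection q) :
    CopenSection p where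
  carrier := φ.g.preimage S.carrier
  isCompact := φ.proper_g.proper _ S.isCompact
  isOpen := (isProperPartial_iff.1 φ.proper_g).1 _ S.isOpen
  injOn := by
    rintro x₁ ⟨y₁, hy₁, h₁⟩ x₂ ⟨y₂, hy₂, h₂⟩ h
    have k₁ := φ.comm _ _ h₁
    have k₂ := φ.comm _ _ h₂
    rw [← h] at k₂
    obtain rfl := S.injOn hy₁ hy₂ (Part.mem_unique k₁ k₂)
    exact (φ.fiber _ _ k₁ y₁ rfl).unique ⟨rfl, h₁⟩ ⟨h.symm, h₂⟩

theorem mem_pullSection {p q : SkewBoolSp.{u}} (φ : SkewBoolHom p q) (S : CopenSection q)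
    {x : p.total} {y : q.total} (h : y ∈ φ.g x) :
    x ∈ (pullSection φ S).carrier ↔ y ∈ S.carrier := by
  constructor
  · rintro ⟨z, hz, h'⟩
    rwa [Part.mem_unique h h']
  · intro hy
    exact ⟨y, hy, h⟩

/-- Inverse images commute with saturations. -/
theorem sat_pullSection {p q : SkewBoolSp.{u}} (φ : SkewBoolHom p q) (S : CopenSection q)
    {x : p.total} {y : q.total} (h : y ∈ φ.g x) :
    x ∈ saturation p (pullSection φ S).carrier ↔ y ∈ saturation q S.carrier := by
  have hb := φ.comm _ _ h
  constructor
  · rintro ⟨x', ⟨z, hz, hx'⟩, e⟩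
    have := φ.comm _ _ hx'
    rw [e] at this
    exact ⟨z, hz, Part.mem_unique this hb⟩
  · rintro ⟨z, hz, e⟩
    obtain ⟨x', ⟨h1, h2⟩, -⟩ := φ.fiber _ _ hb z e
    exact ⟨x', ⟨z, hz, h2⟩, h1⟩

theorem pullSection_eq {p q : SkewBoolSp.{u}} (φ : SkewBoolHom p q) (S : CopenSection q)
    (R : CopenSection p) (hR : R.carrier ⊆ φ.g.Dom)
    (h : ∀ x y, y ∈ φ.g x → (y ∈ S.carrier ↔ x ∈ R.carrier)) : pullSection φ S = R := by
  refine CopenSection.ext_iff'.2 fun x => ⟨?_, fun hx => ?_⟩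
  · rintro ⟨y, hy, hxy⟩
    exact (h x y hxy).1 hy
  · obtain ⟨y, hy⟩ := (PFun.mem_dom _ _).1 (hR hx)
    exact ⟨y, (h x y hy).2 hx, hy⟩

theorem pullSection_subset_dom {p q : SkewBoolSp.{u}} (φ : SkewBoolHom p q)
    (S : CopenSection q) : (pullSection φ S).carrier ⊆ φ.g.Dom := by
  rintro x ⟨y, -, hxy⟩
  exact (PFun.mem_dom _ _).2 ⟨y, hxy⟩

/-- The homomorphism of algebras of copen sections given by inverse image. -/
def pullHom {p q : SkewBoolSp.{u}} (φ : SkewBoolHom p q) :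
    SkewHom (CopenSection q) (CopenSection p) where
  toFun := pullSection φ
  map_zero := pullSection_eq _ _ _ (Set.empty_subset _) fun _ _ _ => Iff.rfl
  map_meet S R := by
    refine pullSection_eq _ _ _
      (Set.inter_subset_right.trans (pullSection_subset_dom φ R)) fun x y h => ?_
    exact and_congr (sat_pullSection φ S h).symm (mem_pullSection φ R h).symm
  map_join S R := by
    refine pullSection_eq _ _ _ (Set.union_subset (pullSection_subset_dom φ S)
      (Set.sdiff_subset.trans (pullSection_subset_dom φ R))) fun x y h => ?_
    exact or_congr (mem_pullSection φ S h).symm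
      (and_congr (mem_pullSection φ R h).symm (not_congr (sat_pullSection φ S h).symm))
  map_diff S R := by
    refine pullSection_eq _ _ _
      (Set.sdiff_subset.trans (pullSection_subset_dom φ S)) fun x y h => ?_
    exact and_congr (mem_pullSection φ S h).symm (not_congr (sat_pullSection φ R h).symm)
  map_inter S R := by
    refine pullSection_eq _ _ _
      (Set.inter_subset_left.trans (pullSection_subset_dom φ S)) fun x y h => ?_
    exact and_congr (mem_pullSection φ S h).symm (mem_pullSection φ R h).symm

end CopenSection

/-- The functor taking a skew Boolean space to its algebra of copen sections and a morphism
`(g, h)` to the inverse image map `g⁻¹`. -/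
def sectionFunctor : SkewBoolSp.{u}ᵒᵖ ⥤ RSkewAlg.{u} where
  obj p := { carrier := CopenSection p.unop, rightHanded := CopenSection.rightHanded }
  map φ := pullHom φ.unop
  map_id p := by
    refine SkewHom.ext (funext fun S => ?_)
    refine pullSection_eq _ _ _ (fun x _ => trivial) fun x y h => ?_
    rw [(mem_id_iff _ _).1 h]
    rfl
  map_comp φ ψ := by
    refine SkewHom.ext (funext fun S => ?_)
    exact CopenSection.ext (PFun.preimage_comp _ _ _)

/-! ### From algebras to spaces -/

/-- A prime ideal: a proper ideal for the natural preorder, such that `a ∧ b ∈ P` implies `a ∈ P`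
or `b ∈ P`. -/
@[ext]
structure PrimeIdeal (A : Type u) [SkewAlgebra A] : Type u where
  carrier : Set A
  zero_mem : zero ∈ carrier
  join_mem : ∀ x y, x ∈ carrier → y ∈ carrier → x ⋎ y ∈ carrier
  lower : ∀ x y, NatPre x y → y ∈ carrier → x ∈ carrier
  ne_univ : carrier ≠ Set.univ
  mem_or_mem : ∀ x y, x ⋏ y ∈ carrier → x ∈ carrier ∨ y ∈ carrier

/-- Congruence relations of skew algebras. -/
structure IsCongruence {A : Type u} [SkewAlgebra A] (r : A → A → Prop) : Prop where
  equiv : Equivalence r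
  meet : ∀ x y x' y', r x x' → r y y' → r (x ⋏ y) (x' ⋏ y')
  join : ∀ x y x' y', r x x' → r y y' → r (x ⋎ y) (x' ⋎ y')
  diff : ∀ x y x' y', r x x' → r y y' → r (diff x y) (diff x' y')
  inter : ∀ x y x' y', r x x' → r y y' → r (inter x y) (inter x' y')

/-- The least congruence whose zero-class contains `I`. -/
def theta {A : Type u} [SkewAlgebra A] (I : Set A) (x y : A) : Prop :=
  ∀ r : A → A → Prop, IsCongruence r → (∀ a ∈ I, r a zero) → r x y

theorem theta_equivalence {A : Type u} [SkewAlgebra A] (I : Set A) : Equivalence (theta I) where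
  refl x _ hr _ := hr.equiv.refl x
  symm h _ hr hI := hr.equiv.symm (h _ hr hI)
  trans h k _ hr hI := hr.equiv.trans (h _ hr hI) (k _ hr hI)

/-- Pairs `(P, t)` with `t ∉ P` represent points of the skew spectrum; two of them represent the
same point when the prime ideals are equal and the elements are congruent. -/
def skewSetoid (A : Type u) [SkewAlgebra A] :
    Setoid {x : PrimeIdeal A × A // x.2 ∉ x.1.carrier} where
  r x y := x.1.1 = y.1.1 ∧ theta x.1.1.carrier x.1.2 y.1.2
  iseqv :=
    { refl := fun x => ⟨rfl, (theta_equivalence _).refl _⟩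
      symm := by
        rintro ⟨⟨P, t⟩, ht⟩ ⟨⟨Q, u⟩, hu⟩ ⟨h, k⟩
        obtain rfl : P = Q := h
        exact ⟨rfl, (theta_equivalence _).symm k⟩
      trans := by
        rintro ⟨⟨P, t⟩, ht⟩ ⟨⟨Q, u⟩, hu⟩ ⟨⟨R, v⟩, hv⟩ ⟨h, k⟩ ⟨h', k'⟩
        obtain rfl : P = Q := h
        obtain rfl : P = R := h'
        exact ⟨rfl, (theta_equivalence _).trans k k'⟩ }

/-- The skew spectrum. -/
def SkewSpec (A : Type u) [SkewAlgebra A] : Type u := Quotient (skewSetoid A)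

/-- The point `(P, [t])` of the skew spectrum. -/
def SkewSpec.mk {A : Type u} [SkewAlgebra A] (P : PrimeIdeal A) (t : A) (h : t ∉ P.carrier) :
    SkewSpec A := Quotient.mk (skewSetoid A) ⟨(P, t), h⟩

/-- The basic copen subset of the spectrum given by an element. -/
def baseN {A : Type u} [SkewAlgebra A] (a : A) : Set (PrimeIdeal A) := {P | a ∉ P.carrier}

/-- The basic copen subset of the skew spectrum given by an element. -/
def baseM {A : Type u} [SkewAlgebra A] (a : A) : Set (SkewSpec A) :=
  {x | ∃ (P : PrimeIdeal A) (h : a ∉ P.carrier), x = SkewSpec.mk P a h}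

instance (A : Type u) [SkewAlgebra A] : TopologicalSpace (PrimeIdeal A) :=
  TopologicalSpace.generateFrom (Set.range baseN)

instance (A : Type u) [SkewAlgebra A] : TopologicalSpace (SkewSpec A) :=
  TopologicalSpace.generateFrom (Set.range baseM)

/-- The projection of the skew spectrum to the spectrum. -/
def specProj (A : Type u) [SkewAlgebra A] : SkewSpec A → PrimeIdeal A :=
  Quotient.lift (fun x => x.1.1) fun _ _ h => h.1

section Spec

variable {A : Type u} [SkewAlgebra A]

theorem specProj_mk (P : PrimeIdeal A) (t : A) (h : t ∉ P.carrier) :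
    specProj A (SkewSpec.mk P t h) = P := rfl

theorem exists_mk (x : SkewSpec A) : ∃ P t h, x = SkewSpec.mk (A := A) P t h := by
  obtain ⟨⟨⟨P, t⟩, h⟩, rfl⟩ := Quotient.exists_rep x
  exact ⟨P, t, h, rfl⟩

theorem mk_eq_mk {P : PrimeIdeal A} {t u : A} {h : t ∉ P.carrier} {k : u ∉ P.carrier} :
    SkewSpec.mk P t h = SkewSpec.mk P u k ↔ theta P.carrier t u := by
  constructor
  · intro e
    exact (Quotient.exact e).2
  · intro e
    exact Quotient.sound ⟨rfl, e⟩

namespace PrimeIdeal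

variable (P : PrimeIdeal A)

theorem meet_mem_iff {x y : A} : x ⋏ y ∈ P.carrier ↔ x ∈ P.carrier ∨ y ∈ P.carrier := by
  refine ⟨P.mem_or_mem x y, ?_⟩
  rintro (h | h)
  · exact P.lower _ _ (meet_natPre_left x y) h
  · exact P.lower _ _ (meet_natPre_right x y) h

theorem join_mem_iff {x y : A} : x ⋎ y ∈ P.carrier ↔ x ∈ P.carrier ∧ y ∈ P.carrier :=
  ⟨fun h => ⟨P.lower _ _ (natPre_join_left x y) h, P.lower _ _ (natPre_join_right x y) h⟩,
    fun h => P.join_mem _ _ h.1 h.2⟩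

theorem mem_of_le {x y : A} (h : NatLE x y) (hy : y ∈ P.carrier) : x ∈ P.carrier :=
  P.lower _ _ (natPre_of_natLE h) hy

theorem diff_mem_iff (hA : RightHanded A) {x y : A} :
    diff x y ∈ P.carrier ↔ x ∈ P.carrier ∨ y ∉ P.carrier := by
  constructor
  · intro h
    by_cases hy : y ∈ P.carrier
    · left
      have e := rh_diff_join hA x y
      rw [← e, join_mem_iff, meet_mem_iff]
      exact ⟨h, Or.inl hy⟩
    · exact Or.inr hy
  · rintro (h | h)
    · exact P.mem_of_le (diff_natLE hA x y) h
    · have e : y ⋏ diff x y ∈ P.carrier := by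
        rw [meet_diff_zero hA]
        exact P.zero_mem
      exact (P.mem_or_mem _ _ e).resolve_left h

/-- Membership description of the congruence of a prime ideal. -/
def Rel (x y : A) : Prop :=
  (x ∈ P.carrier ∧ y ∈ P.carrier) ∨ ∃ z, z ∉ P.carrier ∧ NatLE z x ∧ NatLE z y

theorem Rel.iff {P : PrimeIdeal A} {x y : A} (h : P.Rel x y) :
    x ∈ P.carrier ↔ y ∈ P.carrier := by
  rcases h with h | ⟨z, hz, h1, h2⟩
  · exact iff_of_true h.1 h.2
  · exact iff_of_false (fun h => hz (P.mem_of_le h1 h)) (fun h => hz (P.mem_of_le h2 h))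

theorem rel_of_mem {x y : A} (hx : x ∈ P.carrier) (hy : y ∈ P.carrier) : P.Rel x y :=
  Or.inl ⟨hx, hy⟩

theorem isCongruence_rel (hA : RightHanded A) : IsCongruence P.Rel where
  equiv :=
    { refl := fun x => by
        by_cases h : x ∈ P.carrier
        · exact Or.inl ⟨h, h⟩
        · exact Or.inr ⟨x, h, natLE_refl x, natLE_refl x⟩
      symm := by
        rintro x y (h | ⟨z, hz, h1, h2⟩)
        · exact Or.inl h.symm
        · exact Or.inr ⟨z, hz, h2, h1⟩
      trans := by
        intro x y z hxy hyz
        rcases hxy with h | ⟨a, ha, h1, h2⟩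
        · exact Or.inl ⟨h.1, hyz.iff.1 h.2⟩
        · rcases hyz with h | ⟨b, hb, h3, h4⟩
          · exact absurd (P.mem_of_le h2 h.1) ha
          · refine Or.inr ⟨a ⋏ b, ?_, ?_, ?_⟩
            · rw [meet_mem_iff]
              tauto
            · exact natLE_trans (meet_natLE_left hA h2 h3) h1
            · exact natLE_trans (meet_right_natLE hA a b) h4 }
  meet x y x' y' h k := by
    by_cases hx : x ∈ P.carrier
    · exact Or.inl ⟨P.meet_mem_iff.2 (Or.inl hx), P.meet_mem_iff.2 (Or.inl (h.iff.1 hx))⟩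
    by_cases hy : y ∈ P.carrier
    · exact Or.inl ⟨P.meet_mem_iff.2 (Or.inr hy), P.meet_mem_iff.2 (Or.inr (k.iff.1 hy))⟩
    obtain ⟨z, hz, h1, h2⟩ := h.resolve_left fun h => hx h.1
    obtain ⟨w, hw, h3, h4⟩ := k.resolve_left fun h => hy h.1
    refine Or.inr ⟨z ⋏ w, ?_, meet_natLE_meet hA h1 h3, meet_natLE_meet hA h2 h4⟩
    rw [meet_mem_iff]
    tauto
  join x y x' y' h k := by
    rcases h with ⟨hx, hx'⟩ | ⟨z, hz, h1, h2⟩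
    · rcases k with ⟨hy, hy'⟩ | ⟨w, hw, h3, h4⟩
      · exact Or.inl ⟨P.join_mem _ _ hx hy, P.join_mem _ _ hx' hy'⟩
      · refine Or.inr ⟨SkewAlgebra.diff w (x ⋎ x'), ?_, ?_, ?_⟩
        · rw [P.diff_mem_iff hA, P.join_mem_iff]
          tauto
        · exact diff_natLE_join hA h3 (natPre_join_left x x')
        · exact diff_natLE_join hA h4 (natPre_join_right x x')
    · exact Or.inr ⟨z, hz, natLE_trans h1 (natLE_join_left hA _ _),
        natLE_trans h2 (natLE_join_left hA _ _)⟩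
  diff x y x' y' h k := by
    by_cases hy : y ∈ P.carrier
    · rcases h with ⟨hx, hx'⟩ | ⟨z, hz, h1, h2⟩
      · exact Or.inl ⟨(P.diff_mem_iff hA).2 (Or.inl hx), (P.diff_mem_iff hA).2 (Or.inl hx')⟩
      · refine Or.inr ⟨SkewAlgebra.diff z (y ⋎ y'), ?_, ?_, ?_⟩
        · rw [P.diff_mem_iff hA, P.join_mem_iff]
          have := k.iff
          tauto
        · exact diff_natLE_diff hA h1 (natPre_join_left y y')
        · exact diff_natLE_diff hA h2 (natPre_join_right y y')
    · exact Or.inl ⟨(P.diff_mem_iff hA).2 (Or.inr hy),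
        (P.diff_mem_iff hA).2 (Or.inr fun h => hy (k.iff.2 h))⟩
  inter := by
    have key : ∀ x y x' y' : A, P.Rel x x' → P.Rel y y' →
        SkewAlgebra.inter x y ∉ P.carrier →
        ∃ z, z ∉ P.carrier ∧ NatLE z (SkewAlgebra.inter x y) ∧
          NatLE z (SkewAlgebra.inter x' y') := by
      intro x y x' y' h k hc
      have hcx := inter_natLE_left x y
      have hcy := inter_natLE_right x y
      obtain ⟨z, hz, h1, h2⟩ := h.resolve_left fun h => hc (P.mem_of_le hcx h.1)
      obtain ⟨w, hw, h3, h4⟩ := k.resolve_left fun h => hc (P.mem_of_le hcy h.1)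
      have e1 : NatLE (SkewAlgebra.inter x y ⋏ z) (SkewAlgebra.inter x y) :=
        meet_natLE_left hA hcx h1
      have e2 : NatLE (SkewAlgebra.inter x y ⋏ z) z := meet_right_natLE hA _ z
      have e3 : NatLE (SkewAlgebra.inter x y ⋏ z ⋏ w) (SkewAlgebra.inter x y ⋏ z) :=
        meet_natLE_left hA (natLE_trans e1 hcy) h3
      have e4 : NatLE (SkewAlgebra.inter x y ⋏ z ⋏ w) w := meet_right_natLE hA _ w
      refine ⟨SkewAlgebra.inter x y ⋏ z ⋏ w, ?_, natLE_trans e3 e1, natLE_inter ?_ ?_⟩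
      · rw [meet_mem_iff, meet_mem_iff]
        tauto
      · exact natLE_trans (natLE_trans e3 e2) h2
      · exact natLE_trans e4 h4
    have symm : ∀ x y : A, P.Rel x y → P.Rel y x := by
      rintro x y (h | ⟨z, hz, h1, h2⟩)
      · exact Or.inl h.symm
      · exact Or.inr ⟨z, hz, h2, h1⟩
    intro x y x' y' h k
    by_cases hc : SkewAlgebra.inter x y ∈ P.carrier
    · by_cases hc' : SkewAlgebra.inter x' y' ∈ P.carrier
      · exact Or.inl ⟨hc, hc'⟩
      · exact symm _ _ (Or.inr (key x' y' x y (symm _ _ h) (symm _ _ k) hc'))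
    · exact Or.inr (key x y x' y' h k hc)

theorem theta_iff (hA : RightHanded A) {x y : A} : theta P.carrier x y ↔ P.Rel x y := by
  constructor
  · intro h
    refine h _ (P.isCongruence_rel hA) fun a ha => Or.inl ⟨ha, P.zero_mem⟩
  · rintro (⟨hx, hy⟩ | ⟨z, hz, h1, h2⟩) r hr h0
    · exact hr.equiv.trans (h0 x hx) (hr.equiv.symm (h0 y hy))
    · have key : ∀ x, NatLE z x → r x z := by
        intro x hx
        have e := rh_diff_join hA x z
        rw [hx.1] at e
        have hd : SkewAlgebra.diff x z ∈ P.carrier := (P.diff_mem_iff hA).2 (Or.inr hz)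
        have := hr.join _ z _ z (h0 _ hd) (hr.equiv.refl z)
        rwa [e, zero_join] at this
      exact hr.equiv.trans (key x h1) (hr.equiv.symm (key y h2))

theorem theta_iff_inter (hA : RightHanded A) {x y : A} :
    theta P.carrier x y ↔
      (x ∈ P.carrier ∧ y ∈ P.carrier) ∨ SkewAlgebra.inter x y ∉ P.carrier := by
  rw [theta_iff P hA]
  refine or_congr Iff.rfl ⟨?_, fun h => ⟨_, h, inter_natLE_left x y, inter_natLE_right x y⟩⟩
  rintro ⟨z, hz, h1, h2⟩ h
  exact hz (P.mem_of_le (natLE_inter h1 h2) h)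

end PrimeIdeal

theorem mk_mem_baseM (hA : RightHanded A) {P : PrimeIdeal A} {t a : A} {h : t ∉ P.carrier} :
    SkewSpec.mk P t h ∈ baseM a ↔ inter t a ∉ P.carrier := by
  constructor
  · rintro ⟨Q, hQ, e⟩
    obtain rfl : P = Q := congrArg (specProj A) e
    exact ((P.theta_iff_inter hA).1 (mk_eq_mk.1 e)).resolve_left fun k => h k.1
  · intro hi
    refine ⟨P, fun ha => hi (P.mem_of_le (inter_natLE_right t a) ha), ?_⟩
    exact mk_eq_mk.2 ((P.theta_iff_inter hA).2 (Or.inr hi))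

theorem baseM_inter (hA : RightHanded A) (a b : A) :
    (baseM a ∩ baseM b : Set (SkewSpec A)) = baseM (inter a b) := by
  ext x
  constructor
  · rintro ⟨⟨P, ha, rfl⟩, hb⟩
    have hb' := (mk_mem_baseM hA).1 hb
    refine (mk_mem_baseM hA).2 fun h => hb' (P.mem_of_le ?_ h)
    exact natLE_inter (inter_natLE_left a b) (natLE_refl _)
  · rintro ⟨P, h, rfl⟩
    refine ⟨(mk_mem_baseM hA).2 fun k => h (P.mem_of_le ?_ k),
      (mk_mem_baseM hA).2 fun k => h (P.mem_of_le ?_ k)⟩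
    · exact natLE_inter (natLE_refl _) (inter_natLE_left a b)
    · exact natLE_inter (natLE_refl _) (inter_natLE_right a b)

theorem baseN_inter (a b : A) : (baseN a ∩ baseN b : Set (PrimeIdeal A)) = baseN (a ⋏ b) := by
  ext P
  change (a ∉ P.carrier ∧ b ∉ P.carrier) ↔ a ⋏ b ∉ P.carrier
  rw [P.meet_mem_iff]
  tauto

theorem exists_notMem (P : PrimeIdeal A) : ∃ a, a ∉ P.carrier := by
  by_contra! h
  exact P.ne_univ (Set.eq_univ_of_forall h)

theorem isBasis_baseN :
    TopologicalSpace.IsTopologicalBasis (Set.range (baseN : A → Set (PrimeIdeal A))) where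
  exists_subset_inter := by
    rintro _ ⟨a, rfl⟩ _ ⟨b, rfl⟩ P hP
    exact ⟨_, ⟨a ⋏ b, rfl⟩, by rwa [← baseN_inter], by rw [baseN_inter]⟩
  sUnion_eq := by
    refine Set.eq_univ_of_forall fun P => ?_
    obtain ⟨a, ha⟩ := exists_notMem P
    exact ⟨_, ⟨a, rfl⟩, ha⟩
  eq_generateFrom := rfl

theorem isBasis_baseM (hA : RightHanded A) :
    TopologicalSpace.IsTopologicalBasis (Set.range (baseM : A → Set (SkewSpec A))) where
  exists_subset_inter := by
    rintro _ ⟨a, rfl⟩ _ ⟨b, rfl⟩ x hx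
    exact ⟨_, ⟨inter a b, rfl⟩, by rwa [← baseM_inter hA], by rw [baseM_inter hA]⟩
  sUnion_eq := by
    refine Set.eq_univ_of_forall fun x => ?_
    obtain ⟨P, t, h, rfl⟩ := exists_mk x
    exact ⟨_, ⟨t, rfl⟩, P, h, rfl⟩
  eq_generateFrom := rfl

theorem t2_spec (hA : RightHanded A) : T2Space (PrimeIdeal A) := by
  have key : ∀ (P Q : PrimeIdeal A) (a : A), a ∈ P.carrier → a ∉ Q.carrier →
      ∃ b, P ∈ baseN (A := A) (diff b a) ∧ Q ∈ baseN a ∧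
        Disjoint (baseN (diff b a) : Set (PrimeIdeal A)) (baseN a) := by
    intro P Q a ha ha'
    obtain ⟨b, hb⟩ := exists_notMem P
    refine ⟨b, ?_, ha', ?_⟩
    · change diff b a ∉ P.carrier
      rw [P.diff_mem_iff hA]
      tauto
    · rw [Set.disjoint_left]
      intro R h1 h2
      exact h1 ((R.diff_mem_iff hA).2 (Or.inr h2))
  have op : ∀ a : A, IsOpen (baseN a) := fun a => isBasis_baseN.isOpen ⟨a, rfl⟩
  refine ⟨fun P Q hPQ => ?_⟩
  have : ∃ a, ¬ (a ∈ P.carrier ↔ a ∈ Q.carrier) := by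
    by_contra! h
    exact hPQ (PrimeIdeal.ext (Set.ext h))
  obtain ⟨a, ha⟩ := this
  by_cases h : a ∈ P.carrier
  · obtain ⟨b, h1, h2, h3⟩ := key P Q a h (by tauto)
    exact ⟨_, _, op _, op _, h1, h2, h3⟩
  · obtain ⟨b, h1, h2, h3⟩ := key Q P a (by tauto) h
    exact ⟨_, _, op _, op _, h2, h1, h3.symm⟩

theorem isCompact_baseN (a : A) : IsCompact (baseN a : Set (PrimeIdeal A)) := by
  rw [isCompact_iff_ultrafilter_le_nhds]
  intro U hU
  have hUa : ∀ᶠ P in (U : Filter (PrimeIdeal A)), a ∉ P.carrier := Filter.le_principal_iff.1 hU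
  let Q : PrimeIdeal A :=
    { carrier := {x | ∀ᶠ P in (U : Filter (PrimeIdeal A)), x ∈ P.carrier}
      zero_mem := Filter.Eventually.of_forall fun P => P.zero_mem
      join_mem := fun x y hx hy => by
        filter_upwards [hx, hy] with P h k using P.join_mem x y h k
      lower := fun x y h hy => by
        filter_upwards [hy] with P k using P.lower x y h k
      ne_univ := by
        intro h
        have : a ∈ {x | ∀ᶠ P in (U : Filter (PrimeIdeal A)), x ∈ P.carrier} := by
          rw [h]
          trivial
        exact (Ultrafilter.eventually_not.1 hUa) this
      mem_or_mem := fun x y h => by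
        refine Ultrafilter.eventually_or.1 ?_
        filter_upwards [h] with P k using P.mem_or_mem x y k }
  refine ⟨Q, Ultrafilter.eventually_not.1 hUa, ?_⟩
  intro s hs
  obtain ⟨_, ⟨b, rfl⟩, hb, hbs⟩ := isBasis_baseN.mem_nhds_iff.1 hs
  exact Filter.mem_of_superset (Ultrafilter.eventually_not.2 hb) hbs

theorem isBooleanSpace_of_basis {X ι : Type u} [TopologicalSpace X] [T2Space X] (B : ι → Set X)
    (hB : TopologicalSpace.IsTopologicalBasis (Set.range B)) (hc : ∀ i, IsCompact (B i)) :
    IsBooleanSpace X where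
  t2 := inferInstance
  locallyCompact := by
    refine ⟨fun x n hn => ?_⟩
    obtain ⟨_, ⟨i, rfl⟩, hx, hi⟩ := hB.mem_nhds_iff.1 hn
    exact ⟨B i, (hB.isOpen ⟨i, rfl⟩).mem_nhds hx, hi, hc i⟩
  zeroDim := by
    refine TopologicalSpace.isTopologicalBasis_of_isOpen_of_nhds (fun s hs => hs.2) ?_
    intro x U hx hU
    obtain ⟨_, ⟨i, rfl⟩, hx, hi⟩ := hB.mem_nhds_iff.1 (hU.mem_nhds hx)
    exact ⟨B i, ⟨(hc i).isClosed, hB.isOpen ⟨i, rfl⟩⟩, hx, hi⟩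

theorem isBooleanSpace_spec (hA : RightHanded A) : IsBooleanSpace (PrimeIdeal A) :=
  have := t2_spec hA
  isBooleanSpace_of_basis baseN isBasis_baseN isCompact_baseN

theorem continuous_specProj (hA : RightHanded A) : Continuous (specProj A) := by
  refine isBasis_baseN.continuous_iff.2 ?_
  rintro _ ⟨a, rfl⟩
  rw [isOpen_iff_forall_mem_open]
  intro x hx
  obtain ⟨P, t, h, rfl⟩ := exists_mk x
  refine ⟨baseM (a ⋏ t), ?_, (isBasis_baseM hA).isOpen ⟨_, rfl⟩, ?_⟩
  · rintro _ ⟨Q, hQ, rfl⟩ ha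
    exact hQ (Q.meet_mem_iff.2 (Or.inl ha))
  · refine (mk_mem_baseM hA).2 fun k => ?_
    have : a ⋏ t ∈ P.carrier :=
      P.mem_of_le (natLE_inter (meet_right_natLE hA a t) (natLE_refl _)) k
    rw [P.meet_mem_iff] at this
    exact this.elim hx h

theorem specProj_image_baseM (a : A) : specProj A '' baseM a = baseN a := by
  ext P
  constructor
  · rintro ⟨_, ⟨Q, hQ, rfl⟩, rfl⟩
    exact hQ
  · intro h
    exact ⟨_, ⟨P, h, rfl⟩, rfl⟩

theorem isOpenMap_specProj (hA : RightHanded A) : IsOpenMap (specProj A) := by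
  refine (isBasis_baseM hA).isOpenMap_iff.2 ?_
  rintro _ ⟨a, rfl⟩
  rw [specProj_image_baseM]
  exact isBasis_baseN.isOpen ⟨a, rfl⟩

theorem injOn_specProj (a : A) : Set.InjOn (specProj A) (baseM a) := by
  rintro _ ⟨P, hP, rfl⟩ _ ⟨Q, hQ, rfl⟩ h
  obtain rfl : P = Q := h
  rfl

theorem isLocalHomeomorph_specProj (hA : RightHanded A) : IsLocalHomeomorph (specProj A) := by
  rw [isLocalHomeomorph_iff_isOpenEmbedding_restrict]
  intro x
  obtain ⟨P, t, h, rfl⟩ := exists_mk x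
  have ho : IsOpen (baseM t : Set (SkewSpec A)) := (isBasis_baseM hA).isOpen ⟨t, rfl⟩
  refine ⟨baseM t, ho.mem_nhds ⟨P, h, rfl⟩, ?_⟩
  refine Topology.IsOpenEmbedding.of_continuous_injective_isOpenMap ?_ ?_ ?_
  · exact (continuous_specProj hA).comp continuous_subtype_val
  · exact (injOn_specProj t).injective
  · exact (isOpenMap_specProj hA).comp ho.isOpenMap_subtype_val

theorem surjective_specProj : Function.Surjective (specProj A) := by
  intro P
  obtain ⟨a, ha⟩ := exists_notMem P
  exact ⟨SkewSpec.mk P a ha, rfl⟩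

theorem isCompact_baseM (hA : RightHanded A) (a : A) : IsCompact (baseM a : Set (SkewSpec A)) := by
  have hc := isCompact_iff_compactSpace.1 (isCompact_baseN a)
  have : baseM a = Set.range fun P : (baseN a : Set (PrimeIdeal A)) => SkewSpec.mk P.1 a P.2 := by
    ext x
    constructor
    · rintro ⟨P, h, rfl⟩
      exact ⟨⟨P, h⟩, rfl⟩
    · rintro ⟨⟨P, h⟩, rfl⟩
      exact ⟨P, h, rfl⟩
  rw [this]
  refine isCompact_range ((isBasis_baseM hA).continuous_iff.2 ?_)
  rintro _ ⟨b, rfl⟩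
  have : (fun P : (baseN a : Set (PrimeIdeal A)) => SkewSpec.mk P.1 a P.2) ⁻¹' baseM b
      = Subtype.val ⁻¹' baseN (inter a b) := by
    ext P
    exact mk_mem_baseM hA
  rw [this]
  exact (isBasis_baseN.isOpen ⟨_, rfl⟩).preimage continuous_subtype_val

theorem t2_skewSpec (hA : RightHanded A) : T2Space (SkewSpec A) := by
  have := t2_spec hA
  refine ⟨fun x y hxy => ?_⟩
  by_cases hp : specProj A x = specProj A y
  · obtain ⟨P, s, hs, rfl⟩ := exists_mk x
    obtain ⟨Q, t, ht, rfl⟩ := exists_mk y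
    obtain rfl : P = Q := hp
    have op : ∀ a : A, IsOpen (baseM a) := fun a => (isBasis_baseM hA).isOpen ⟨a, rfl⟩
    have hst : inter s t ∈ P.carrier := by
      by_contra h
      exact hxy (mk_eq_mk.2 ((P.theta_iff_inter hA).2 (Or.inr h)))
    have hm : ∀ u, u ∉ P.carrier → ∀ h, SkewSpec.mk P u h ∈ baseM (diff u (inter s t)) := by
      intro u hu h
      refine (mk_mem_baseM hA).2 fun k => ?_
      have := P.mem_of_le (natLE_inter (diff_natLE hA u (inter s t)) (natLE_refl _)) k
      rw [P.diff_mem_iff hA] at this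
      tauto
    refine ⟨_, _, op (diff s (inter s t)), op (diff t (inter s t)), hm s hs hs, hm t ht ht, ?_⟩
    rw [Set.disjoint_left]
    rintro _ ⟨Q, hQ, rfl⟩ hQ'
    have h1 := (mk_mem_baseM hA).1 hQ'
    have h2 : NatLE (inter (diff s (inter s t)) (diff t (inter s t))) (inter s t) :=
      natLE_inter (natLE_trans (inter_natLE_left _ _) (diff_natLE hA _ _))
        (natLE_trans (inter_natLE_right _ _) (diff_natLE hA _ _))
    have h3 : inter s t ∉ Q.carrier := fun h => h1 (Q.mem_of_le h2 h)
    exact hQ ((Q.diff_mem_iff hA).2 (Or.inr h3))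
  · obtain ⟨U, V, hU, hV, hx, hy, hd⟩ := t2_separation hp
    exact ⟨_, _, hU.preimage (continuous_specProj hA), hV.preimage (continuous_specProj hA),
      hx, hy, hd.preimage _⟩

theorem isBooleanSpace_skewSpec (hA : RightHanded A) : IsBooleanSpace (SkewSpec A) :=
  have := t2_skewSpec hA
  isBooleanSpace_of_basis baseM (isBasis_baseM hA) (isCompact_baseM hA)

end Spec

/-- The partial map with a given graph. -/
noncomputable def partialOfGraph {X Y : Type u} (r : X → Y → Prop) : X →. Y :=
  fun x => ⟨∃ y, r x y, fun h => h.choose⟩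

theorem mem_partialOfGraph {X Y : Type u} {r : X → Y → Prop}
    (hr : ∀ x y z, r x y → r x z → y = z) (x : X) (y : Y) : y ∈ partialOfGraph r x ↔ r x y := by
  constructor
  · rintro ⟨h, rfl⟩
    exact h.choose_spec
  · intro h
    have h' : ∃ y, r x y := ⟨y, h⟩
    exact ⟨h', hr _ _ _ h'.choose_spec h⟩

section SpecMap

variable {A B : Type u} [SkewAlgebra A] [SkewAlgebra B]

/-- The graph of the partial map of spectra: a prime ideal goes to its preimage, when that is
again a prime ideal. -/
def downRel (f : SkewHom A B) (P : PrimeIdeal B) (Q : PrimeIdeal A) : Prop :=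
  Q.carrier = f.toFun ⁻¹' P.carrier

/-- The graph of the partial map of skew spectra: it sends `(P, [f a])` to `(f⁻¹ P, [a])`. -/
def upRel (f : SkewHom A B) (x : SkewSpec B) (y : SkewSpec A) : Prop :=
  ∃ (P : PrimeIdeal B) (Q : PrimeIdeal A) (a : A) (hP : f.toFun a ∉ P.carrier)
    (hQ : a ∉ Q.carrier), downRel f P Q ∧ x = SkewSpec.mk P (f.toFun a) hP ∧ y = SkewSpec.mk Q a hQ

noncomputable def downMap (f : SkewHom A B) : PrimeIdeal B →. PrimeIdeal A :=
  partialOfGraph (downRel f)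

noncomputable def upMap (f : SkewHom A B) : SkewSpec B →. SkewSpec A :=
  partialOfGraph (upRel f)

theorem mem_downMap (f : SkewHom A B) (P : PrimeIdeal B) (Q : PrimeIdeal A) :
    Q ∈ downMap f P ↔ Q.carrier = f.toFun ⁻¹' P.carrier :=
  mem_partialOfGraph (fun _ _ _ h k => PrimeIdeal.ext (h.trans k.symm)) P Q

theorem map_natLE (f : SkewHom A B) {x y : A} (h : NatLE x y) :
    NatLE (f.toFun x) (f.toFun y) := by
  refine ⟨?_, ?_⟩
  · rw [← f.map_meet, h.1]
  · rw [← f.map_meet, h.2]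

theorem map_natPre (f : SkewHom A B) {x y : A} (h : NatPre x y) :
    NatPre (f.toFun x) (f.toFun y) := by
  unfold NatPre at *
  rw [← f.map_meet, ← f.map_meet, h]

/-- The preimage of a prime ideal not containing the image of the homomorphism. -/
def PrimeIdeal.comap (f : SkewHom A B) (P : PrimeIdeal B) (a : A) (h : f.toFun a ∉ P.carrier) :
    PrimeIdeal A where
  carrier := f.toFun ⁻¹' P.carrier
  zero_mem := by
    change f.toFun _ ∈ P.carrier
    rw [f.map_zero]
    exact P.zero_mem
  join_mem x y hx hy := by
    change f.toFun _ ∈ P.carrier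
    rw [f.map_join]
    exact P.join_mem _ _ hx hy
  lower x y hxy hy := P.lower _ _ (map_natPre f hxy) hy
  ne_univ e := h (by
    have : a ∈ f.toFun ⁻¹' P.carrier := by
      rw [e]
      trivial
    exact this)
  mem_or_mem x y hxy := by
    change f.toFun _ ∈ P.carrier at hxy
    rw [f.map_meet] at hxy
    exact P.mem_or_mem _ _ hxy

theorem theta_comap (hA : RightHanded A) (hB : RightHanded B) (f : SkewHom A B) {P : PrimeIdeal B}
    {Q : PrimeIdeal A} (h : downRel f P Q) (a b : A) :
    theta Q.carrier a b ↔ theta P.carrier (f.toFun a) (f.toFun b) := by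
  rw [P.theta_iff_inter hB, Q.theta_iff_inter hA, h, ← f.map_inter]
  rfl

theorem mem_upMap (hA : RightHanded A) (hB : RightHanded B) (f : SkewHom A B) (x : SkewSpec B)
    (y : SkewSpec A) : y ∈ upMap f x ↔ upRel f x y := by
  refine mem_partialOfGraph ?_ x y
  rintro _ _ _ ⟨P, Q, a, hP, hQ, h, rfl, rfl⟩ ⟨P', Q', a', hP', hQ', h', e, rfl⟩
  obtain rfl : P = P' := congrArg (specProj B) e
  obtain rfl : Q = Q' := PrimeIdeal.ext (h.trans h'.symm)
  exact mk_eq_mk.2 ((theta_comap hA hB f h a a').2 (mk_eq_mk.1 e))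

theorem downMap_preimage_baseN (f : SkewHom A B) (a : A) :
    (downMap f).preimage (baseN a) = baseN (f.toFun a) := by
  ext P
  constructor
  · rintro ⟨Q, hQ, h⟩
    have h' := (mem_downMap f P Q).1 h
    intro hP
    exact hQ (by rw [h']; exact hP)
  · intro h
    exact ⟨P.comap f a h, h, (mem_downMap _ _ _).2 rfl⟩

theorem upMap_preimage_baseM (hA : RightHanded A) (hB : RightHanded B) (f : SkewHom A B) (a : A) :
    (upMap f).preimage (baseM a) = baseM (f.toFun a) := by
  ext x
  constructor
  · rintro ⟨_, ⟨Q, hQ, rfl⟩, h⟩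
    obtain ⟨P, Q', b, hP, hQ', hd, rfl, e⟩ := (mem_upMap hA hB _ _ _).1 h
    obtain rfl : Q = Q' := congrArg (specProj A) e
    have hP' : f.toFun a ∉ P.carrier := fun k => hQ (by rw [hd]; exact k)
    refine ⟨P, hP', mk_eq_mk.2 ?_⟩
    exact (theta_comap hA hB f hd b a).1 (mk_eq_mk.1 e.symm)
  · rintro ⟨P, h, rfl⟩
    refine ⟨SkewSpec.mk (P.comap f a h) a h, ⟨_, h, rfl⟩, (mem_upMap hA hB _ _ _).2 ?_⟩
    exact ⟨P, P.comap f a h, a, h, h, rfl, rfl, rfl⟩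

theorem isProperPartial_of_basis {X Y ι : Type u} [TopologicalSpace X] [TopologicalSpace Y]
    [T2Space Y] (f : X →. Y) (C : ι → Set Y)
    (hC : TopologicalSpace.IsTopologicalBasis (Set.range C))
    (ho : ∀ i, IsOpen (f.preimage (C i))) (hc : ∀ i, IsCompact (f.preimage (C i))) :
    IsProperPartial f := by
  have op : ∀ s, IsOpen s → IsOpen (f.preimage s) := by
    intro s hs
    rw [isOpen_iff_forall_mem_open]
    rintro x ⟨y, hy, hxy⟩
    obtain ⟨_, ⟨i, rfl⟩, hi, his⟩ := hC.mem_nhds_iff.1 (hs.mem_nhds hy)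
    exact ⟨f.preimage (C i), f.preimage_mono his, ho i, y, hi, hxy⟩
  refine isProperPartial_iff.2 ⟨op, fun K hK => ?_⟩
  obtain ⟨t, ht⟩ := hK.elim_finite_subcover C (fun i => hC.isOpen ⟨i, rfl⟩) (fun y _ => by
    obtain ⟨_, ⟨i, rfl⟩, hi, -⟩ := hC.mem_nhds_iff.1 (isOpen_univ.mem_nhds (Set.mem_univ y))
    exact Set.mem_iUnion.2 ⟨i, hi⟩)
  have : f.preimage K = (⋃ i ∈ t, f.preimage (C i)) \ f.preimage Kᶜ := by
    ext x
    constructor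
    · rintro ⟨y, hy, hxy⟩
      obtain ⟨i, hi, hyi⟩ := Set.mem_iUnion₂.1 (ht hy)
      refine ⟨Set.mem_iUnion₂.2 ⟨i, hi, y, hyi, hxy⟩, ?_⟩
      rintro ⟨z, hz, hxz⟩
      exact hz (Part.mem_unique hxy hxz ▸ hy)
    · rintro ⟨h1, h2⟩
      obtain ⟨i, hi, y, -, hxy⟩ := Set.mem_iUnion₂.1 h1
      refine ⟨y, ?_, hxy⟩
      by_contra hy
      exact h2 ⟨y, hy, hxy⟩
  rw [this]
  exact (t.isCompact_biUnion fun i _ => hc i).diff (op _ hK.isClosed.isOpen_compl)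

theorem isProperPartial_downMap (hA : RightHanded A) (f : SkewHom A B) :
    IsProperPartial (downMap f) := by
  have := t2_spec hA
  refine isProperPartial_of_basis _ baseN isBasis_baseN (fun a => ?_) (fun a => ?_)
  · rw [downMap_preimage_baseN]
    exact isBasis_baseN.isOpen ⟨_, rfl⟩
  · rw [downMap_preimage_baseN]
    exact isCompact_baseN _

theorem isProperPartial_upMap (hA : RightHanded A) (hB : RightHanded B) (f : SkewHom A B) :
    IsProperPartial (upMap f) := by
  have := t2_skewSpec hA
  refine isProperPartial_of_basis _ baseM (isBasis_baseM hA) (fun a => ?_) (fun a => ?_)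
  · rw [upMap_preimage_baseM hA hB]
    exact (isBasis_baseM hB).isOpen ⟨_, rfl⟩
  · rw [upMap_preimage_baseM hA hB]
    exact isCompact_baseM hB _

end SpecMap

/-- The skew Boolean space of a right-handed algebra. -/
def specSpace (A : RSkewAlg.{u}) : SkewBoolSp.{u} where
  total := SkewSpec A.carrier
  base := PrimeIdeal A.carrier
  proj := specProj A.carrier
  booleanTotal := isBooleanSpace_skewSpec A.rightHanded
  booleanBase := isBooleanSpace_spec A.rightHanded
  etale := isLocalHomeomorph_specProj A.rightHanded
  surj := surjective_specProj

/-- The morphism of skew Boolean spaces induced by a homomorphism. -/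
noncomputable def specMap {A B : RSkewAlg.{u}} (f : SkewHom A.carrier B.carrier) :
    SkewBoolHom (specSpace B) (specSpace A) where
  g := upMap f
  h := downMap f
  proper_g := isProperPartial_upMap A.rightHanded B.rightHanded f
  proper_h := isProperPartial_downMap A.rightHanded f
  comm := by
    intro x y h
    obtain ⟨P, Q, a, hP, hQ, hd, rfl, rfl⟩ := (mem_upMap A.rightHanded B.rightHanded f x y).1 h
    exact (mem_downMap f P Q).2 hd
  fiber := by
    intro P Q hQ y hy
    have hd : downRel f P Q := (mem_downMap f P Q).1 hQ
    obtain ⟨Q', a, ha, rfl⟩ := exists_mk y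
    obtain rfl : Q' = Q := hy
    have hP : f.toFun a ∉ P.carrier := fun k => ha (by rw [hd]; exact k)
    refine ⟨SkewSpec.mk P (f.toFun a) hP, ⟨rfl,
      (mem_upMap A.rightHanded B.rightHanded f _ _).2 ⟨P, Q', a, hP, ha, hd, rfl, rfl⟩⟩, ?_⟩
    rintro x ⟨hx, h⟩
    obtain ⟨P', Q, b, hP', hb, hd', rfl, e⟩ :=
      (mem_upMap A.rightHanded B.rightHanded f _ _).1 h
    obtain rfl : P' = P := hx
    obtain rfl : Q' = Q := congrArg (specProj A.carrier) e
    exact mk_eq_mk.2 ((theta_comap A.rightHanded B.rightHanded f hd b a).1 (mk_eq_mk.1 e.symm))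

/-- The functor taking a right-handed algebra to its skew Boolean space. -/
noncomputable def specFunctor : RSkewAlg.{u}ᵒᵖ ⥤ SkewBoolSp.{u} where
  obj A := specSpace A.unop
  map f := specMap f.unop
  map_id A := by
    refine SkewBoolHom.ext ?_ ?_
    · refine PFun.ext fun x y => ?_
      refine (mem_upMap A.unop.rightHanded A.unop.rightHanded _ x y).trans
        (Iff.trans ?_ (mem_id_iff x y).symm)
      constructor
      · rintro ⟨P, Q, a, hP, hQ, hd, rfl, rfl⟩
        obtain rfl : Q = P := PrimeIdeal.ext hd
        rfl
      · rintro rfl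
        obtain ⟨P, a, h, rfl⟩ := exists_mk y
        exact ⟨P, P, a, h, h, rfl, rfl, rfl⟩
    · refine PFun.ext fun P Q => ?_
      refine (mem_downMap _ P Q).trans (Iff.trans ?_ (mem_id_iff P Q).symm)
      exact ⟨fun h => PrimeIdeal.ext h, fun h => by rw [h]; rfl⟩
  map_comp {A B C} f g := by
    refine SkewBoolHom.ext ?_ ?_
    · refine PFun.ext fun x z => ?_
      refine (mem_upMap C.unop.rightHanded A.unop.rightHanded _ x z).trans
        (Iff.trans ?_ (mem_comp_iff _ _ x z).symm)
      constructor
      · rintro ⟨P, Q, a, hP, hQ, hd, rfl, rfl⟩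
        have h1 : downRel f.unop P (P.comap f.unop (g.unop.toFun a) hP) := by
          unfold downRel
          rfl
        have h2 : downRel g.unop (P.comap f.unop (g.unop.toFun a) hP) Q := hd
        exact ⟨SkewSpec.mk (P.comap f.unop (g.unop.toFun a) hP) (g.unop.toFun a) hP,
          (mem_upMap B.unop.rightHanded A.unop.rightHanded _ _ _).2
            ⟨P, _, g.unop.toFun a, hP, hP, h1, rfl, rfl⟩,
          (mem_upMap C.unop.rightHanded B.unop.rightHanded _ _ _).2
            ⟨_, Q, a, hP, hQ, h2, rfl, rfl⟩⟩
      · rintro ⟨y, h1, h2⟩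
        obtain ⟨P, Q, b, hP, hQ, hd, rfl, e⟩ :=
          (mem_upMap B.unop.rightHanded A.unop.rightHanded _ _ _).1 h1
        obtain ⟨Q', R, a, hQ', hR, hd', rfl, rfl⟩ :=
          (mem_upMap C.unop.rightHanded B.unop.rightHanded _ _ _).1 h2
        obtain rfl : Q' = Q := congrArg (specProj B.unop.carrier) e
        have hP' : f.unop.toFun (g.unop.toFun a) ∉ P.carrier := fun k =>
          hQ' (by rw [hd]; exact k)
        refine ⟨P, R, a, hP', hR, ?_, ?_, rfl⟩
        · unfold downRel at *
          rw [hd', hd]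
          rfl
        · exact mk_eq_mk.2 ((theta_comap B.unop.rightHanded A.unop.rightHanded f.unop hd _ _).1
            (mk_eq_mk.1 e.symm))
    · refine PFun.ext fun P R => ?_
      refine (mem_downMap _ P R).trans (Iff.trans ?_ (mem_comp_iff _ _ P R).symm)
      constructor
      · intro h
        obtain ⟨a, ha⟩ := exists_notMem R
        have ha' : f.unop.toFun (g.unop.toFun a) ∉ P.carrier := fun k => ha (by rw [h]; exact k)
        exact ⟨P.comap f.unop (g.unop.toFun a) ha', (mem_downMap _ _ _).2 rfl,
          (mem_downMap _ _ _).2 h⟩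
      · rintro ⟨Q, h1, h2⟩
        have h1' := (mem_downMap _ _ _).1 h1
        have h2' := (mem_downMap _ _ _).1 h2
        rw [h2', h1']
        rfl

end SkewDuality

namespace SkewDuality

open SkewAlgebra

/-! ### Prime ideals separate elements -/

section PrimeIdealTheorem

variable {A : Type u} [SkewAlgebra A]

/-! This is a Stone-type duality in which prime ideals are points of the base and congruence classes
modulo a prime ideal are points of a fibre.

On the algebra side, `a` goes to the section `baseM a` of its classes. Every operation is computed
pointwise, since an element below `b` in the natural order is the restriction of `b` to a smaller
support (`mem_baseM_iff_of_natLE`). Injectivity is the prime ideal theorem `exists_primeIdeal`: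
supports determine elements up to the natural preorder, and equivalent elements below a common one
are equal (`eq_of_below`). Surjectivity is compactness: inside a fixed section joins are unions, so
a finite cover by basic sections glues to a single element (`CopenSection.mem_of_covered`).

On the space side, a base point `b` goes to the prime ideal of sections missing its fibre, and a
point `x` of the total space to the class of any section through `x`. These maps are bijective by
Hausdorffness and compactness (`pointIdeal_surjective`, `pointGerm_surjective`) and match bases of
the topologies, hence are homeomorphisms. Naturality on the algebra side is the formula for
preimages of basic sections; on the space side it comes down to the fibre condition on morphisms
(`downRel_pointIdeal`).

For the restricted duality, the ideal generated by the inverse images under `(g, h)` consists of the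
sections contained in `dom g`, while the natural preorder only compares images in the base. The
ideal is thus closed under the preorder exactly when `dom g` is a union of whole fibres, which must
be those over `dom h`. The criterion for homomorphisms follows by transport along the natural
isomorphism with the double dual, and isomorphisms lie in both classes, so the duality restricts. -/

theorem join_natPre (hA : RightHanded A) {x y z : A} (h : NatPre x z) (k : NatPre y z) :
    NatPre (x ⋎ y) z := by
  rw [natPre_iff hA] at *
  rw [meet_distrib_left, h, k]

/-- Elements of the algebra are separated by prime ideals, up to the natural preorder. -/
theorem exists_primeIdeal (hA : RightHanded A) {x y : A} (hxy : ¬ NatPre x y) :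
    ∃ P : PrimeIdeal A, y ∈ P.carrier ∧ x ∉ P.carrier := by
  let F : Set (Set A) := {I | (zero ∈ I ∧ (∀ a b, a ∈ I → b ∈ I → a ⋎ b ∈ I) ∧
    ∀ a b, NatPre a b → b ∈ I → a ∈ I) ∧ x ∉ I}
  have zero_natPre : ∀ z : A, NatPre zero z := fun z => by
    unfold NatPre
    rw [zero_meet, zero_meet]
  -- Zorn's lemma applies to the ideals for the natural preorder that omit `x`, starting from the
  -- principal ideal of `y`, which omits `x` by hypothesis.
  obtain ⟨P, hyP, hP⟩ := zorn_subset_nonempty F (by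
    intro c hc hch hne
    refine ⟨⋃₀ c, ⟨⟨?_, ?_, ?_⟩, ?_⟩, fun s hs => Set.subset_sUnion_of_mem hs⟩
    · obtain ⟨s, hs⟩ := hne
      exact ⟨s, hs, (hc hs).1.1⟩
    · rintro a b ⟨s, hs, ha⟩ ⟨t, ht, hb⟩
      rcases hch.total hs ht with h | h
      · exact ⟨t, ht, (hc ht).1.2.1 a b (h ha) hb⟩
      · exact ⟨s, hs, (hc hs).1.2.1 a b ha (h hb)⟩
    · rintro a b hab ⟨s, hs, hb⟩
      exact ⟨s, hs, (hc hs).1.2.2 a b hab hb⟩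
    · rintro ⟨s, hs, hx⟩
      exact (hc hs).2 hx) {a | NatPre a y}
    ⟨⟨zero_natPre y, fun a b => join_natPre hA, fun a b => natPre_trans hA⟩, hxy⟩
  obtain ⟨⟨⟨h0, hj, hl⟩, hx⟩, hmax⟩ := hP
  -- By maximality, the ideal generated by `P` and an outside element `a` must contain `x`.
  have key : ∀ a, a ∉ P → ∃ p ∈ P, NatPre x (p ⋎ a) := by
    intro a ha
    by_contra hne
    refine ha (hmax (y := {c | ∃ p ∈ P, NatPre c (p ⋎ a)}) ⟨⟨?_, ?_, ?_⟩, hne⟩ ?_ ?_)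
    · exact ⟨zero, h0, zero_natPre _⟩
    · rintro c d ⟨p, hp, hc⟩ ⟨q, hq, hd⟩
      refine ⟨p ⋎ q, hj _ _ hp hq, join_natPre hA (natPre_trans hA hc ?_)
        (natPre_trans hA hd ?_)⟩
      · exact natPre_join hA (natPre_join_left p q) (natPre_of_natLE (natLE_refl a))
      · exact natPre_join hA (natPre_join_right p q) (natPre_of_natLE (natLE_refl a))
    · rintro c d hcd ⟨p, hp, hd⟩
      exact ⟨p, hp, natPre_trans hA hcd hd⟩
    · exact fun p hp => ⟨p, hp, natPre_join_left p a⟩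
    · exact ⟨zero, h0, natPre_join_right _ _⟩
  refine ⟨⟨P, h0, hj, hl, fun h => hx (h ▸ Set.mem_univ x), ?_⟩,
    hyP (natPre_of_natLE (natLE_refl y)), hx⟩
  intro a b hab
  by_contra! hn
  obtain ⟨p, hp, h1⟩ := key a hn.1
  obtain ⟨q, hq, h2⟩ := key b hn.2
  rw [natPre_iff hA] at h1 h2
  -- Both joins fix `x` when meeting it from the left, hence so does their meet. Expanded by
  -- distributivity, each term of that meet has a factor `p` or `q` or equals `a ⋏ b`, so the meet
  -- lies in `P` and drags `x` into `P`.
  have e : (p ⋎ a) ⋏ (q ⋎ b) ∈ P := by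
    rw [meet_distrib_right, meet_distrib_left a]
    exact hj _ _ (hl _ _ (meet_natPre_left _ _) hp)
      (hj _ _ (hl _ _ (meet_natPre_right _ _) hq) hab)
  refine hx ?_
  rw [← h1, ← h2, ← meet_assoc]
  exact hl _ _ (meet_natPre_left _ _) e

theorem natPre_of_baseN_subset (hA : RightHanded A) {x y : A}
    (h : (baseN x : Set (PrimeIdeal A)) ⊆ baseN y) : NatPre x y := by
  by_contra hn
  obtain ⟨P, hy, hx⟩ := exists_primeIdeal hA hn
  exact h hx hy

/-- If `a` and `b` give the same section, so does `inter a b`. Thus `inter a b` and `a` have the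
same support and are equivalent for the preorder; both lie below `a`, so they coincide. By symmetry
`a ≤ b ≤ a`. -/
theorem baseM_injective (hA : RightHanded A) :
    Function.Injective (baseM : A → Set (SkewSpec A)) := by
  have key : ∀ a b : A, (baseM a : Set (SkewSpec A)) = baseM b → inter a b = a := by
    intro a b h
    have h1 : baseM (inter a b) = (baseM a : Set (SkewSpec A)) := by
      rw [← baseM_inter hA, h, Set.inter_self]
    have h2 : NatPre a (inter a b) := natPre_of_baseN_subset hA (by
      rw [← specProj_image_baseM, ← specProj_image_baseM, h1])
    refine eq_of_below hA (inter_natLE_left a b) (natLE_refl a) ((natPre_iff hA).1 h2) ?_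
    exact (inter_natLE_left a b).2
  intro a b h
  have h1 : NatLE a b := by
    rw [← key a b h]
    exact inter_natLE_right a b
  have h2 : NatLE b a := by
    rw [← key b a h.symm]
    exact inter_natLE_right b a
  exact h1.1.symm.trans h2.2

end PrimeIdealTheorem

/-! ### The algebra of copen sections of a skew spectrum -/

section BaseHom

variable {A : Type u} [SkewAlgebra A]

/-- At a prime ideal missing `a`, the element `a` itself witnesses that `a` and `b` are congruent.
The section of an element below `b` is therefore the section of `b` cut down to a smaller support,
which reduces the operations to membership in prime ideals. -/
theorem mem_baseM_iff_of_natLE (hA : RightHanded A) {a b : A} (hab : NatLE a b) (x : SkewSpec A) :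
    x ∈ baseM a ↔ x ∈ baseM b ∧ a ∉ (specProj A x).carrier := by
  have key : ∀ (P : PrimeIdeal A) (h : a ∉ P.carrier) (k : b ∉ P.carrier),
      SkewSpec.mk P a h = SkewSpec.mk P b k := fun P h k =>
    mk_eq_mk.2 ((P.theta_iff hA).2 (Or.inr ⟨a, h, natLE_refl a, hab⟩))
  constructor
  · rintro ⟨P, h, rfl⟩
    have k : b ∉ P.carrier := fun k => h (P.mem_of_le hab k)
    exact ⟨⟨P, k, key P h k⟩, h⟩
  · rintro ⟨⟨P, k, rfl⟩, h⟩
    exact ⟨P, h, (key P h k).symm⟩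

theorem notMem_specProj_of_mem_baseM {a : A} {x : SkewSpec A} (h : x ∈ baseM a) :
    a ∉ (specProj A x).carrier := by
  obtain ⟨P, h, rfl⟩ := h
  exact h

theorem mem_baseM_meet (hA : RightHanded A) (a b : A) (x : SkewSpec A) :
    x ∈ baseM (a ⋏ b) ↔ a ∉ (specProj A x).carrier ∧ x ∈ baseM b := by
  rw [mem_baseM_iff_of_natLE hA (meet_right_natLE hA a b), PrimeIdeal.meet_mem_iff]
  have : x ∈ baseM b → b ∉ (specProj A x).carrier := notMem_specProj_of_mem_baseM
  tauto

theorem mem_baseM_diff (hA : RightHanded A) (a b : A) (x : SkewSpec A) :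
    x ∈ baseM (diff a b) ↔ x ∈ baseM a ∧ ¬ b ∉ (specProj A x).carrier := by
  rw [mem_baseM_iff_of_natLE hA (diff_natLE hA a b), PrimeIdeal.diff_mem_iff _ hA]
  have : x ∈ baseM a → a ∉ (specProj A x).carrier := notMem_specProj_of_mem_baseM
  tauto

/-- Both `a` and `diff b a` lie below `a ⋎ b`, and their supports are disjoint and together exhaust
that of `a ⋎ b`. Restricting the section of the join to these two supports gives the two cases. -/
theorem mem_baseM_join (hA : RightHanded A) (a b : A) (x : SkewSpec A) :
    x ∈ baseM (a ⋎ b) ↔ x ∈ baseM a ∨ x ∈ baseM b ∧ ¬ a ∉ (specProj A x).carrier := by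
  have h1 := mem_baseM_iff_of_natLE hA (natLE_join_left hA a b) x
  have h2 := mem_baseM_iff_of_natLE hA (diff_natLE_join hA (natLE_refl b)
    (natPre_of_natLE (natLE_refl a))) x
  have h3 := mem_baseM_diff hA b a x
  have h4 := @notMem_specProj_of_mem_baseM _ _ (a ⋎ b) x
  have h5 := @notMem_specProj_of_mem_baseM _ _ b x
  rw [PrimeIdeal.diff_mem_iff _ hA] at h2
  rw [PrimeIdeal.join_mem_iff] at h4
  tauto

end BaseHom

variable (A : RSkewAlg.{u})

/-- The basic copen section given by an element. -/
def baseSection (a : A.carrier) : CopenSection (specSpace A) where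
  carrier := baseM a
  isCompact := isCompact_baseM A.rightHanded a
  isOpen := (isBasis_baseM A.rightHanded).isOpen ⟨a, rfl⟩
  injOn := injOn_specProj a

theorem mem_saturation_baseSection (a : A.carrier) (x : SkewSpec A.carrier) :
    x ∈ saturation (specSpace A) (baseSection A a).carrier ↔
      a ∉ (specProj A.carrier x).carrier := by
  change specProj A.carrier x ∈ specProj A.carrier '' baseM a ↔ _
  rw [specProj_image_baseM]
  rfl

/-- The homomorphism from an algebra to the copen sections of its skew spectrum. -/
def baseHom : SkewHom A.carrier (CopenSection (specSpace A)) where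
  toFun := baseSection A
  map_zero := by
    refine CopenSection.ext_iff'.2 fun x => iff_of_false ?_ id
    exact fun h => notMem_specProj_of_mem_baseM h (specProj A.carrier x).zero_mem
  map_meet a b := CopenSection.ext_iff'.2 fun x => (mem_baseM_meet A.rightHanded a b x).trans
    (and_congr_left' (mem_saturation_baseSection A a x).symm)
  map_join a b := CopenSection.ext_iff'.2 fun x => (mem_baseM_join A.rightHanded a b x).trans
    (or_congr_right (and_congr_right' (not_congr (mem_saturation_baseSection A a x).symm)))
  map_diff a b := CopenSection.ext_iff'.2 fun x => (mem_baseM_diff A.rightHanded a b x).trans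
    (and_congr_right' (not_congr (mem_saturation_baseSection A b x).symm))
  map_inter a b := CopenSection.ext (baseM_inter A.rightHanded a b).symm

/-- The join discards the points of `R` whose fibre meets `S`; when both sections sit in a set on
which the projection is injective, such points already belong to `S`. -/
theorem CopenSection.carrier_join_eq_union {p : SkewBoolSp.{u}} {S R : CopenSection p}
    {U : Set p.total} (hU : Set.InjOn p.proj U) (hS : S.carrier ⊆ U) (hR : R.carrier ⊆ U) :
    (S ⋎ R).carrier = S.carrier ∪ R.carrier := by
  ext x
  refine (CopenSection.mem_join S R x).trans ⟨fun h => h.imp id And.left, ?_⟩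
  rintro (h | h)
  · exact Or.inl h
  · by_cases hx : x ∈ saturation p S.carrier
    · obtain ⟨y, hy, e⟩ := hx
      exact Or.inl (hU (hS hy) (hR h) e ▸ hy)
    · exact Or.inr ⟨h, hx⟩

/-- A copen section covered by the sections it contains from a family closed under joins
belongs to the family. -/
theorem CopenSection.mem_of_covered {p : SkewBoolSp.{u}} {F : Set (CopenSection p)}
    (h0 : zero ∈ F) (hj : ∀ S R, S ∈ F → R ∈ F → S ⋎ R ∈ F) (T : CopenSection p)
    (hT : ∀ x ∈ T.carrier, ∃ S ∈ F, x ∈ S.carrier ∧ S.carrier ⊆ T.carrier) : T ∈ F := by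
  -- Only members inside `T` are used for the cover: the projection is injective on `T`, so their
  -- joins are unions, and no join leaves `T`.
  let G : Set (CopenSection p) := {S | S ∈ F ∧ S.carrier ⊆ T.carrier}
  obtain ⟨t, ht⟩ := T.isCompact.elim_finite_subcover (fun S : G => S.1.carrier)
    (fun S => S.1.isOpen) fun x hx => by
      obtain ⟨S, h1, h2, h3⟩ := hT x hx
      exact Set.mem_iUnion.2 ⟨⟨S, h1, h3⟩, h2⟩
  have key : ∀ t : Finset G, ∃ S ∈ G, S.carrier = ⋃ R ∈ t, R.1.carrier := by
    classical
    intro t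
    induction t using Finset.induction_on with
    | empty =>
      refine ⟨zero, ⟨h0, Set.empty_subset _⟩, ?_⟩
      simp only [Finset.notMem_empty, Set.iUnion_of_empty, Set.iUnion_empty]
      rfl
    | insert R t _ ih =>
      obtain ⟨S, hS, e⟩ := ih
      have hu := CopenSection.carrier_join_eq_union T.injOn R.2.2 hS.2
      refine ⟨R.1 ⋎ S, ⟨hj _ _ R.2.1 hS.1, ?_⟩, ?_⟩
      · rw [hu]
        exact Set.union_subset R.2.2 hS.2
      · rw [hu, Finset.set_biUnion_insert, e]
  obtain ⟨S, hS, e⟩ := key t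
  have : S = T := CopenSection.ext (Set.Subset.antisymm hS.2 (e ▸ ht))
  exact this ▸ hS.1

/-- For surjectivity, the basic sections form a basis of the topology and are closed under joins
because `baseHom` preserves them; the covering criterion then yields every section. -/
theorem bijective_baseSection : Function.Bijective (baseSection A) := by
  refine ⟨fun a b h => baseM_injective A.rightHanded (congrArg CopenSection.carrier h),
    fun T => ?_⟩
  refine CopenSection.mem_of_covered (F := Set.range (baseSection A))
    ⟨zero, (baseHom A).map_zero⟩ ?_ T fun x hx => ?_
  · rintro _ _ ⟨a, rfl⟩ ⟨b, rfl⟩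
    exact ⟨a ⋎ b, (baseHom A).map_join a b⟩
  · obtain ⟨_, ⟨a, rfl⟩, h1, h2⟩ :=
      (isBasis_baseM A.rightHanded).mem_nhds_iff.1 (T.isOpen.mem_nhds hx)
    exact ⟨_, ⟨a, rfl⟩, h1, h2⟩

/-- A bijective homomorphism is an isomorphism. -/
noncomputable def isoOfBijective {A B : RSkewAlg.{u}} (f : SkewHom A.carrier B.carrier)
    (hf : Function.Bijective f.toFun) : A ≅ B :=
  have inv := Function.surjInv_eq hf.2
  { hom := f
    inv :=
      { toFun := Function.surjInv hf.2
        map_zero := hf.1 (by rw [inv, f.map_zero])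
        map_meet := fun x y => hf.1 (by rw [inv, f.map_meet, inv, inv])
        map_join := fun x y => hf.1 (by rw [inv, f.map_join, inv, inv])
        map_diff := fun x y => hf.1 (by rw [inv, f.map_diff, inv, inv])
        map_inter := fun x y => hf.1 (by rw [inv, f.map_inter, inv, inv]) }
    hom_inv_id := SkewHom.ext (funext fun x => hf.1 (inv (f.toFun x)))
    inv_hom_id := SkewHom.ext (funext inv) }

/-- A right-handed algebra is naturally isomorphic to the algebra of copen sections of its skew
spectrum. -/
noncomputable def sectionSpecIso :
    𝟭 RSkewAlg.{u} ≅ specFunctor.{u}.rightOp ⋙ sectionFunctor.{u} :=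
  NatIso.ofComponents
    (fun A => isoOfBijective (B := sectionFunctor.obj (op (specSpace A))) (baseHom A)
      (bijective_baseSection A))
    fun {A B} f => SkewHom.ext (funext fun a => CopenSection.ext
      (upMap_preimage_baseM A.rightHanded B.rightHanded f a).symm)

/-! ### The skew spectrum of an algebra of copen sections -/

section Points

variable (p : SkewBoolSp.{u})

/-- A point has a compact neighbourhood inside `U` and the source of a local inverse, and a clopen
set inside that neighbourhood. The clopen set is closed in a compact set, hence compact, and the
projection is injective on it. -/
theorem exists_section {x : p.total} {U : Set p.total} (hU : IsOpen U) (hx : x ∈ U) :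
    ∃ S : CopenSection p, x ∈ S.carrier ∧ S.carrier ⊆ U := by
  have := p.booleanTotal.locallyCompact
  obtain ⟨e, he, hpe⟩ := p.etale x
  obtain ⟨K, hK, hKU, hKc⟩ := local_compact_nhds
    ((hU.inter e.open_source).mem_nhds (⟨hx, he⟩ : x ∈ U ∩ e.source))
  obtain ⟨C, hC, hxC, hCK⟩ := p.booleanTotal.zeroDim.mem_nhds_iff.1 hK
  refine ⟨⟨C, hKc.of_isClosed_subset hC.1 hCK, hC.2, ?_⟩, hxC,
    fun y hy => (hKU (hCK hy)).1⟩
  rw [hpe]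
  exact e.injOn.mono fun y hy => (hKU (hCK hy)).2

theorem isBasis_section :
    TopologicalSpace.IsTopologicalBasis (Set.range (CopenSection.carrier (p := p))) := by
  refine TopologicalSpace.isTopologicalBasis_of_isOpen_of_nhds ?_ fun x U hx hU => ?_
  · rintro _ ⟨S, rfl⟩
    exact S.isOpen
  · obtain ⟨S, h1, h2⟩ := exists_section p hU hx
    exact ⟨_, ⟨S, rfl⟩, h1, h2⟩

theorem isBasis_image_section : TopologicalSpace.IsTopologicalBasis
    (Set.range fun S : CopenSection p => p.proj '' S.carrier) := by
  refine TopologicalSpace.isTopologicalBasis_of_isOpen_of_nhds ?_ fun b U hb hU => ?_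
  · rintro _ ⟨S, rfl⟩
    exact p.etale.isOpenMap _ S.isOpen
  · obtain ⟨x, rfl⟩ := p.surj b
    obtain ⟨S, h1, h2⟩ := exists_section p (hU.preimage p.etale.continuous) hb
    exact ⟨_, ⟨S, rfl⟩, ⟨x, h1, rfl⟩, Set.image_subset_iff.2 h2⟩

/-- In the right-handed case the preorder says `R ⋏ S = S`, that is, `S` lies in the saturation of
`R`. -/
theorem CopenSection.natPre_iff_image {S R : CopenSection p} :
    NatPre S R ↔ p.proj '' S.carrier ⊆ p.proj '' R.carrier := by
  rw [natPre_iff CopenSection.rightHanded, Set.image_subset_iff]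
  refine CopenSection.ext_iff'.trans ⟨fun h x hx => ((h x).2 hx).1, fun h x => ?_⟩
  exact ⟨And.right, fun hx => ⟨h hx, hx⟩⟩

/-- The prime ideal of copen sections missing a point of the base. -/
def pointIdeal (b : p.base) : PrimeIdeal (CopenSection p) where
  carrier := {S | b ∉ p.proj '' S.carrier}
  zero_mem := by
    rintro ⟨x, hx, -⟩
    exact hx
  join_mem S R hS hR := by
    -- Lifting `b` to the total space turns membership in an image into membership in a saturation,
    -- where the formulas for the operations apply.
    obtain ⟨x, rfl⟩ := p.surj b
    exact fun h => ((CopenSection.sat_join S R x).1 h).elim hS hR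
  lower S R h hR hS := hR ((CopenSection.natPre_iff_image p).1 h hS)
  ne_univ h := by
    obtain ⟨x, rfl⟩ := p.surj b
    obtain ⟨S, hS, -⟩ := exists_section p isOpen_univ (Set.mem_univ x)
    have : S ∈ {S : CopenSection p | p.proj x ∉ p.proj '' S.carrier} := h ▸ Set.mem_univ S
    exact this ⟨x, hS, rfl⟩
  mem_or_mem S R h := by
    obtain ⟨x, rfl⟩ := p.surj b
    by_contra! hn
    exact h ((CopenSection.sat_meet S R x).2 ⟨not_not.1 hn.1, not_not.1 hn.2⟩)

theorem notMem_pointIdeal {b : p.base} {S : CopenSection p} :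
    S ∉ (pointIdeal p b).carrier ↔ b ∈ p.proj '' S.carrier := not_not

theorem pointIdeal_preimage_baseN (S : CopenSection p) :
    pointIdeal p ⁻¹' baseN S = p.proj '' S.carrier :=
  Set.ext fun _ => notMem_pointIdeal p

/-- The base is Hausdorff, so some section has an image containing `b` and avoiding `c`. -/
theorem pointIdeal_injective : Function.Injective (pointIdeal p) := by
  intro b c h
  by_contra hne
  have := p.booleanBase.t2
  obtain ⟨_, ⟨S, rfl⟩, hb, hc⟩ := (isBasis_image_section p).mem_nhds_iff.1
    (isOpen_compl_singleton.mem_nhds (show b ∈ ({c}ᶜ : Set p.base) from hne))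
  exact hc ((notMem_pointIdeal p).1 (h ▸ (notMem_pointIdeal p).2 hb)) rfl

theorem pointIdeal_surjective : Function.Surjective (pointIdeal p) := by
  intro Q
  have := p.booleanBase.t2
  obtain ⟨T, hT⟩ := exists_notMem Q
  have hcl : ∀ S : CopenSection p, IsCompact (p.proj '' S.carrier) := fun S =>
    S.isCompact.image p.etale.continuous
  have hop : ∀ S : CopenSection p, IsOpen (p.proj '' S.carrier) := fun S =>
    p.etale.isOpenMap _ S.isOpen
  -- The desired base point lies in the image of a fixed `T ∉ Q` and outside the images of all
  -- members of `Q`. Joins in `Q` make these compact differences directed, and none is empty, since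
  -- otherwise `T` would be below a member of `Q`.
  have hne : (⋂ S : Q.carrier, p.proj '' T.carrier \ p.proj '' S.1.carrier).Nonempty := by
    have : Nonempty Q.carrier := ⟨⟨zero, Q.zero_mem⟩⟩
    refine IsCompact.nonempty_iInter_of_directed_nonempty_isCompact_isClosed _ ?_ ?_
      (fun S => (hcl T).diff (hop S.1)) (fun S => ((hcl T).diff (hop S.1)).isClosed)
    · intro S R
      refine ⟨⟨S.1 ⋎ R.1, Q.join_mem _ _ S.2 R.2⟩, ?_, ?_⟩
      · exact Set.sdiff_subset_sdiff_right
          ((CopenSection.natPre_iff_image p).1 (natPre_join_left S.1 R.1))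
      · exact Set.sdiff_subset_sdiff_right
          ((CopenSection.natPre_iff_image p).1 (natPre_join_right S.1 R.1))
    · intro S
      by_contra hn
      rw [Set.not_nonempty_iff_eq_empty, Set.sdiff_eq_empty] at hn
      exact hT (Q.lower _ _ ((CopenSection.natPre_iff_image p).2 hn) S.2)
  obtain ⟨b, hb⟩ := hne
  rw [Set.mem_iInter] at hb
  refine ⟨b, PrimeIdeal.ext (Set.ext fun S => ⟨fun hS => ?_, fun hS => (hb ⟨S, hS⟩).2⟩)⟩
  by_contra hn
  -- If `S ∉ Q`, primeness puts `diff T S` in `Q`, so `b` avoids its image; but `b` is in the image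
  -- of `T` and not in that of `S`.
  have hd : SkewAlgebra.diff T S ∈ Q.carrier :=
    (Q.diff_mem_iff CopenSection.rightHanded).2 (Or.inr hn)
  obtain ⟨x, rfl⟩ := p.surj b
  exact (hb ⟨_, hd⟩).2 ((CopenSection.sat_diff T S x).2 ⟨(hb ⟨_, hd⟩).1, hS⟩)

/-- A copen section through a point of the total space. -/
noncomputable def sectionAt (x : p.total) : CopenSection p :=
  (exists_section p isOpen_univ (Set.mem_univ x)).choose

theorem mem_sectionAt (x : p.total) : x ∈ (sectionAt p x).carrier :=
  (exists_section p isOpen_univ (Set.mem_univ x)).choose_spec.1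

theorem notMem_pointIdeal_of_mem {x : p.total} {S : CopenSection p} (h : x ∈ S.carrier) :
    S ∉ (pointIdeal p (p.proj x)).carrier :=
  (notMem_pointIdeal p).2 ⟨x, h, rfl⟩

/-- The point of the skew spectrum given by a point of the total space. -/
noncomputable def pointGerm (x : p.total) : SkewSpec (CopenSection p) :=
  SkewSpec.mk (pointIdeal p (p.proj x)) (sectionAt p x)
    (notMem_pointIdeal_of_mem p (mem_sectionAt p x))

/-- The class does not depend on the chosen section: two sections through `x` have an intersection
that still passes through `x`, hence lies outside the ideal. -/
theorem pointGerm_eq {x : p.total} {S : CopenSection p} (h : x ∈ S.carrier) :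
    pointGerm p x = SkewSpec.mk (pointIdeal p (p.proj x)) S (notMem_pointIdeal_of_mem p h) :=
  mk_eq_mk.2 ((PrimeIdeal.theta_iff_inter _ CopenSection.rightHanded).2
    (Or.inr (notMem_pointIdeal_of_mem p (S := SkewAlgebra.inter _ _) ⟨mem_sectionAt p x, h⟩)))

/-- Two sections are congruent at `p.proj x` when their intersection has a point over it. As the
projection is injective on `sectionAt p x`, that point can only be `x`. -/
theorem pointGerm_preimage_baseM (S : CopenSection p) :
    pointGerm p ⁻¹' baseM S = S.carrier := by
  ext x
  refine (mk_mem_baseM CopenSection.rightHanded).trans ((notMem_pointIdeal p).trans ?_)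
  constructor
  · rintro ⟨y, ⟨h1, h2⟩, e⟩
    rwa [← (sectionAt p x).injOn h1 (mem_sectionAt p x) e]
  · exact fun h => ⟨x, ⟨mem_sectionAt p x, h⟩, rfl⟩

theorem pointGerm_injective : Function.Injective (pointGerm p) := by
  intro x y h
  by_contra hne
  have := p.booleanTotal.t2
  obtain ⟨S, hx, hy⟩ := exists_section p isOpen_compl_singleton
    (show x ∈ ({y}ᶜ : Set p.total) from hne)
  rw [← pointGerm_preimage_baseM, Set.mem_preimage, h, ← Set.mem_preimage,
    pointGerm_preimage_baseM] at hx
  exact hy hx rfl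

theorem pointGerm_surjective : Function.Surjective (pointGerm p) := by
  intro z
  obtain ⟨Q, S, hS, rfl⟩ := exists_mk z
  obtain ⟨b, rfl⟩ := pointIdeal_surjective p Q
  obtain ⟨x, hx, rfl⟩ := (notMem_pointIdeal p).1 hS
  exact ⟨x, pointGerm_eq p hx⟩

end Points

/-- A bijection matching bases of two topologies is a homeomorphism. -/
noncomputable def homeomorphOfBasis {X Y ι : Type u} [TopologicalSpace X] [TopologicalSpace Y]
    (f : X → Y) (hf : Function.Bijective f) {C : ι → Set X} {D : ι → Set Y}
    (hC : TopologicalSpace.IsTopologicalBasis (Set.range C))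
    (hD : TopologicalSpace.IsTopologicalBasis (Set.range D)) (h : ∀ i, f ⁻¹' D i = C i) :
    X ≃ₜ Y :=
  (Equiv.ofBijective f hf).toHomeomorphOfContinuousOpen
    (hD.continuous_iff.2 (by
      rintro _ ⟨i, rfl⟩
      exact (h i).symm ▸ hC.isOpen ⟨i, rfl⟩))
    (hC.isOpenMap_iff.2 (by
      rintro _ ⟨i, rfl⟩
      refine (congrArg IsOpen ?_).mpr (hD.isOpen ⟨i, rfl⟩)
      rw [← h i]
      exact Set.image_preimage_eq _ hf.2))

theorem isProperPartial_homeomorph {X Y : Type u} [TopologicalSpace X] [TopologicalSpace Y]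
    (e : X ≃ₜ Y) : IsProperPartial (e : X →. Y) := by
  refine isProperPartial_iff.2 ⟨fun s hs => ?_, fun K hK => ?_⟩
  · rw [PFun.coe_preimage]
    exact hs.preimage e.continuous
  · rw [PFun.coe_preimage]
    exact e.isCompact_preimage.2 hK

theorem mem_coe_iff {X Y : Type u} (f : X → Y) (x : X) (y : Y) : y ∈ (f : X →. Y) x ↔ y = f x :=
  Part.mem_some_iff

/-- The morphism given by homeomorphisms of the total and base spaces. -/
def homOfHomeomorph {p q : SkewBoolSp.{u}} (e : p.total ≃ₜ q.total) (d : p.base ≃ₜ q.base)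
    (h : ∀ x, q.proj (e x) = d (p.proj x)) : p ⟶ q :=
  show SkewBoolHom p q from
  { g := (e : p.total → q.total)
    h := (d : p.base → q.base)
    proper_g := isProperPartial_homeomorph e
    proper_h := isProperPartial_homeomorph d
    comm := by
      intro x y hy
      rw [mem_coe_iff] at *
      rw [hy, h]
    fiber := by
      intro b c hc y hy
      rw [mem_coe_iff] at hc
      refine ⟨e.symm y, ⟨d.injective ?_, ?_⟩, ?_⟩
      · rw [← h, e.apply_symm_apply, hy, hc]
      · rw [mem_coe_iff, e.apply_symm_apply]
      · rintro x ⟨-, hx⟩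
        rw [mem_coe_iff] at hx
        rw [hx, e.symm_apply_apply] }

/-- The isomorphism given by homeomorphisms of the total and base spaces. -/
def isoOfHomeomorph {p q : SkewBoolSp.{u}} (e : p.total ≃ₜ q.total) (d : p.base ≃ₜ q.base)
    (h : ∀ x, q.proj (e x) = d (p.proj x)) : p ≅ q where
  hom := homOfHomeomorph e d h
  inv := homOfHomeomorph e.symm d.symm fun y => by
    apply d.injective
    rw [← h, e.apply_symm_apply, d.apply_symm_apply]
  hom_inv_id := by
    refine SkewBoolHom.ext (PFun.ext fun x y => ?_) (PFun.ext fun x y => ?_)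
    · refine (mem_comp_iff _ _ x y).trans (Iff.trans ?_ (mem_id_iff x y).symm)
      constructor
      · rintro ⟨z, h1, h2⟩
        rw [(mem_coe_iff _ _ _).1 h2, (mem_coe_iff _ _ _).1 h1, e.symm_apply_apply]
      · rintro rfl
        exact ⟨_, (mem_coe_iff _ _ _).2 rfl,
          (mem_coe_iff _ _ _).2 (e.symm_apply_apply y).symm⟩
    · refine (mem_comp_iff _ _ x y).trans (Iff.trans ?_ (mem_id_iff x y).symm)
      constructor
      · rintro ⟨z, h1, h2⟩
        rw [(mem_coe_iff _ _ _).1 h2, (mem_coe_iff _ _ _).1 h1, d.symm_apply_apply]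
      · rintro rfl
        exact ⟨_, (mem_coe_iff _ _ _).2 rfl,
          (mem_coe_iff _ _ _).2 (d.symm_apply_apply y).symm⟩
  inv_hom_id := by
    refine SkewBoolHom.ext (PFun.ext fun x y => ?_) (PFun.ext fun x y => ?_)
    · refine (mem_comp_iff _ _ x y).trans (Iff.trans ?_ (mem_id_iff x y).symm)
      constructor
      · rintro ⟨z, h1, h2⟩
        rw [(mem_coe_iff _ _ _).1 h2, (mem_coe_iff _ _ _).1 h1, e.apply_symm_apply]
      · rintro rfl
        exact ⟨_, (mem_coe_iff _ _ _).2 rfl,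
          (mem_coe_iff _ _ _).2 (e.apply_symm_apply y).symm⟩
    · refine (mem_comp_iff _ _ x y).trans (Iff.trans ?_ (mem_id_iff x y).symm)
      constructor
      · rintro ⟨z, h1, h2⟩
        rw [(mem_coe_iff _ _ _).1 h2, (mem_coe_iff _ _ _).1 h1, d.apply_symm_apply]
      · rintro rfl
        exact ⟨_, (mem_coe_iff _ _ _).2 rfl,
          (mem_coe_iff _ _ _).2 (d.apply_symm_apply y).symm⟩

/-- The isomorphism from a skew Boolean space to the skew spectrum of its copen sections. -/
noncomputable def spaceIso (p : SkewBoolSp.{u}) :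
    p ≅ specFunctor.obj (op (sectionFunctor.obj (op p))) :=
  isoOfHomeomorph (q := specSpace (sectionFunctor.obj (op p)))
    (homeomorphOfBasis (pointGerm p) ⟨pointGerm_injective p, pointGerm_surjective p⟩
      (isBasis_section p) (isBasis_baseM CopenSection.rightHanded) (pointGerm_preimage_baseM p))
    (homeomorphOfBasis (pointIdeal p) ⟨pointIdeal_injective p, pointIdeal_surjective p⟩
      (isBasis_image_section p) isBasis_baseN (pointIdeal_preimage_baseN p))
    fun _ => rfl

/-! ### Naturality on the space side -/

/-- Values of partial maps are unique, so a square of this kind commutes once the graph of `f` maps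
into that of `f'` and the domain of `f'` pulls back into that of `f`. -/
theorem comp_coe_eq {X X' Y Y' : Type u} (f : X →. Y) (f' : X' →. Y') (i : X → X')
    (j : Y → Y') (h1 : ∀ x y, y ∈ f x → j y ∈ f' (i x)) (h2 : ∀ x, i x ∈ f'.Dom → x ∈ f.Dom) :
    (j : Y →. Y').comp f = f'.comp (i : X →. X') := by
  refine PFun.ext fun x z => (mem_comp_iff _ _ x z).trans
    (Iff.trans ?_ (mem_comp_iff _ _ x z).symm)
  constructor
  · rintro ⟨y, hy, hz⟩
    rw [mem_coe_iff] at hz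
    exact ⟨i x, (mem_coe_iff _ _ _).2 rfl, hz ▸ h1 x y hy⟩
  · rintro ⟨w, hw, hz⟩
    rw [mem_coe_iff] at hw
    subst hw
    obtain ⟨y, hy⟩ := (PFun.mem_dom f x).1 (h2 x ((PFun.mem_dom _ _).2 ⟨z, hz⟩))
    exact ⟨y, hy, (mem_coe_iff _ _ _).2 (Part.mem_unique hz (h1 x y hy))⟩

/-- An inverse image meets the fibre over `b` exactly when the section meets the fibre over `c`:
existence in the fibre condition lifts points, and commutativity of the square pushes them down. -/
theorem downRel_pointIdeal {p q : SkewBoolSp.{u}} (φ : SkewBoolHom p q) {b : p.base}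
    {c : q.base} (h : c ∈ φ.h b) : downRel (pullHom φ) (pointIdeal p b) (pointIdeal q c) := by
  refine Set.ext fun S => not_congr ⟨?_, ?_⟩
  · rintro ⟨y, hy, e⟩
    obtain ⟨x, ⟨hx, hxy⟩, -⟩ := φ.fiber b c h y e
    exact ⟨x, ⟨y, hy, hxy⟩, hx⟩
  · rintro ⟨x, ⟨y, hy, hxy⟩, rfl⟩
    exact ⟨y, hy, Part.mem_unique (φ.comm x y hxy) h⟩

theorem spaceIso_naturality {p q : SkewBoolSp.{u}} (φ : p ⟶ q) :
    φ ≫ (spaceIso q).hom =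
      (spaceIso p).hom ≫ specFunctor.map (sectionFunctor.map φ.op).op := by
  have hp := CopenSection.rightHanded (p := p)
  have hq := CopenSection.rightHanded (p := q)
  refine SkewBoolHom.ext
    (comp_coe_eq (SkewBoolHom.g φ) (upMap (pullHom φ)) (pointGerm p) (pointGerm q) ?_ ?_)
    (comp_coe_eq (SkewBoolHom.h φ) (downMap (pullHom φ)) (pointIdeal p) (pointIdeal q) ?_ ?_)
  · intro x y h
    -- The class at `x` is represented by the inverse image of a section through `y`, which has the
    -- form `f a` required by `upRel`.
    have hx : x ∈ (pullSection φ (sectionAt q y)).carrier := ⟨y, mem_sectionAt q y, h⟩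
    refine (mem_upMap hq hp _ _ _).2 ⟨_, _, sectionAt q y, notMem_pointIdeal_of_mem p hx, _,
      downRel_pointIdeal φ (SkewBoolHom.comm φ x y h), pointGerm_eq p hx, rfl⟩
  · intro x h
    obtain ⟨z, hz⟩ := (PFun.mem_dom _ _).1 h
    obtain ⟨P, Q, S, hP, hQ, hd, e, -⟩ := (mem_upMap hq hp _ _ _).1 hz
    -- A class in the domain of `upMap` is represented by an inverse image, which must then pass
    -- through `x`; inverse images lie in the domain of `g`.
    have : x ∈ pointGerm p ⁻¹' baseM ((pullHom φ).toFun S) := ⟨P, hP, e⟩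
    rw [pointGerm_preimage_baseM] at this
    exact pullSection_subset_dom φ S this
  · intro b c h
    exact (mem_downMap _ _ _).2 (downRel_pointIdeal φ h)
  · intro b h
    obtain ⟨Q, hQ⟩ := (PFun.mem_dom _ _).1 h
    obtain ⟨S, hS⟩ := exists_notMem Q
    rw [(mem_downMap _ _ _).1 hQ] at hS
    obtain ⟨x, ⟨y, -, hxy⟩, rfl⟩ := (notMem_pointIdeal p).1 hS
    exact (PFun.mem_dom _ _).2 ⟨_, SkewBoolHom.comm φ x y hxy⟩

/-- A skew Boolean space is naturally isomorphic to the skew spectrum of its copen sections. -/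
noncomputable def specSectionIso :
    𝟭 SkewBoolSp.{u}ᵒᵖ ≅ sectionFunctor.{u} ⋙ specFunctor.{u}.rightOp :=
  NatIso.ofComponents (fun p => (spaceIso p.unop).op.symm) fun {p q} φ =>
    (Iso.eq_inv_comp (spaceIso p.unop).op).2 (by
      refine (Category.assoc _ _ _).symm.trans ((Iso.comp_inv_eq (spaceIso q.unop).op).2 ?_)
      exact congrArg Quiver.Hom.op (spaceIso_naturality φ.unop))

/-- The duality between skew Boolean spaces and right-handed algebras. -/
noncomputable def skewDuality : SkewBoolSp.{u}ᵒᵖ ≌ RSkewAlg.{u} :=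
  -- No triangle identity is checked: this constructor corrects the unit and leaves both functors
  -- untouched.
  CategoryTheory.Equivalence.mk sectionFunctor specFunctor.rightOp specSectionIso
    sectionSpecIso.symm

/-! ### Saturated morphisms -/

/-- The `≤`-ideal generated by the inverse images along a morphism consists of the copen sections
contained in the domain of the morphism. -/
theorem mem_leIdeal_range_pullSection {p q : SkewBoolSp.{u}} (φ : SkewBoolHom p q)
    (T : CopenSection p) : T ∈ leIdeal (Set.range (pullSection φ)) ↔ T.carrier ⊆ φ.g.Dom := by
  have hI := isLEIdeal_leIdeal (Set.range (pullSection φ))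
  constructor
  · intro h
    refine (leIdeal_subset ⟨?_, ?_, ?_⟩ ?_ : _ ⊆ {T : CopenSection p | T.carrier ⊆ φ.g.Dom}) h
    · exact Set.empty_subset _
    · exact fun S R hS hR => Set.union_subset hS (Set.sdiff_subset.trans hR)
    · exact fun S R h hR => ((CopenSection.le_iff S R).1 h).trans hR
    · rintro _ ⟨S, rfl⟩
      exact pullSection_subset_dom φ S
  · intro h
    refine CopenSection.mem_of_covered hI.zero_mem hI.join_mem T fun x hx => ?_
    obtain ⟨y, hy⟩ := (PFun.mem_dom _ _).1 (h hx)
    -- Intersecting with an inverse image through `x` gives a piece of `T` around `x` that lies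
    -- below a generator, hence in the ideal.
    refine ⟨inter T (pullSection φ (sectionAt q y)),
      hI.lower _ _ (inter_natLE_right _ _) (subset_leIdeal _ ⟨_, rfl⟩),
      ⟨hx, y, mem_sectionAt q y, hy⟩, Set.inter_subset_left⟩

/-- The ideal consists of the sections inside `dom g`, and the preorder compares images in the base.
If `dom g` is the full preimage of `dom h`, only the image of a section matters; the converse
constructs, for each point over `dom h`, a section through it that lies in the ideal. -/
theorem saturated_iff_preClosedImage {p q : SkewBoolSp.{u}} (φ : p ⟶ q) :
    saturated φ ↔ preClosedImage (sectionFunctor.map φ.op) := by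
  have key := mem_leIdeal_range_pullSection φ
  have hd : ∀ x, x ∈ (SkewBoolHom.g φ).Dom → p.proj x ∈ (SkewBoolHom.h φ).Dom := fun x hx => by
    obtain ⟨y, hy⟩ := (PFun.mem_dom _ _).1 hx
    exact (PFun.mem_dom _ _).2 ⟨_, SkewBoolHom.comm φ x y hy⟩
  constructor
  · intro h S R hSR hR
    have h' : ∀ x, x ∈ (SkewBoolHom.g φ).Dom ↔ p.proj x ∈ (SkewBoolHom.h φ).Dom :=
      fun x => Set.ext_iff.1 h x
    refine (key S).2 fun x hx => (h' x).2 ?_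
    obtain ⟨y, hy, e⟩ := (CopenSection.natPre_iff_image p).1 hSR ⟨x, hx, rfl⟩
    rw [← e]
    exact hd y ((key R).1 hR hy)
  · refine fun h => Set.ext fun x => ⟨hd x, fun hx => ?_⟩
    obtain ⟨c, hc⟩ := (PFun.mem_dom _ _).1 hx
    -- Surjectivity of `q` makes the fibre over `c` nonempty, so the fibre condition supplies some
    -- `x'` in `dom g` over the same base point as `x`.
    obtain ⟨y, rfl⟩ := q.surj c
    obtain ⟨x', ⟨e, hy⟩, -⟩ := SkewBoolHom.fiber φ _ _ hc y rfl
    have hx' : x' ∈ (pullSection φ (sectionAt q y)).carrier := ⟨y, mem_sectionAt q y, hy⟩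
    -- This meet is the part of a section through `x` over the image of an inverse image through
    -- `x'`. It contains `x`, and it lies below a generator only in the preorder, which is where the
    -- hypothesis enters.
    have hm := h (pullSection φ (sectionAt q y) ⋏ sectionAt p x) _ (meet_natPre_left _ _)
      (subset_leIdeal _ ⟨_, rfl⟩)
    exact (key _).1 hm ⟨⟨x', hx', e⟩, mem_sectionAt p x⟩

/-! ### Isomorphisms and the restricted duality -/

/-- An isomorphism is surjective, so the generated ideal is the whole algebra. -/
theorem isomorphisms_le_preClosedImage :
    MorphismProperty.isomorphisms RSkewAlg.{u} ≤ preClosedImage := by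
  intro A B f hf x y _ _
  have : IsIso f := hf
  refine subset_leIdeal _ ⟨SkewHom.toFun (inv f) x, ?_⟩
  exact congrFun (congrArg SkewHom.toFun (IsIso.inv_hom_id f)) x

theorem isomorphisms_le_saturated :
    MorphismProperty.isomorphisms SkewBoolSp.{u} ≤ saturated := by
  intro p q φ hφ
  have : IsIso φ := hφ
  exact (saturated_iff_preClosedImage φ).2 (isomorphisms_le_preClosedImage _
    (inferInstanceAs (IsIso (sectionFunctor.map φ.op))))

instance : preClosedImage.{u}.RespectsIso :=
  MorphismProperty.respectsIso_of_isStableUnderComposition isomorphisms_le_preClosedImage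

/-- By naturality of `sectionSpecIso`, `f` is isomorphic as an arrow to its double dual; the
property is invariant under such isomorphisms, so the criterion for morphisms of spaces applies to
`specFunctor.map f.op`. -/
theorem preClosedImage_iff_saturated {A B : RSkewAlg.{u}} (f : A ⟶ B) :
    preClosedImage f ↔ saturated (specFunctor.map f.op) := by
  rw [saturated_iff_preClosedImage]
  exact preClosedImage.arrow_mk_iso_iff
    (Arrow.isoMk (sectionSpecIso.app A) (sectionSpecIso.app B)
      (sectionSpecIso.hom.naturality f).symm)

theorem preClosedImage_iso_hom {A B : RSkewAlg.{u}} (e : A ≅ B) : preClosedImage e.hom :=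
  isomorphisms_le_preClosedImage _ (inferInstanceAs (IsIso e.hom))

theorem saturated_iso_hom {p q : SkewBoolSp.{u}} (e : p ≅ q) : saturated e.hom :=
  isomorphisms_le_saturated _ (inferInstanceAs (IsIso e.hom))

/-- The restriction of the section functor to saturated morphisms. -/
def saturatedSectionFunctor :
    (WideSubcategory saturated.{u})ᵒᵖ ⥤ WideSubcategory preClosedImage.{u} where
  obj p := ⟨sectionFunctor.obj (op p.unop.obj)⟩
  map φ := ⟨sectionFunctor.map φ.unop.hom.op,
    (saturated_iff_preClosedImage φ.unop.hom).1 φ.unop.property⟩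
  map_id _ := WideSubcategory.hom_ext _ (sectionFunctor.map_id _)
  map_comp φ ψ := WideSubcategory.hom_ext _
    (sectionFunctor.map_comp φ.unop.hom.op ψ.unop.hom.op)

/-- The restriction of the spectrum functor to homomorphisms with pre-closed image. -/
noncomputable def preClosedSpecFunctor :
    WideSubcategory preClosedImage.{u} ⥤ (WideSubcategory saturated.{u})ᵒᵖ where
  obj A := op ⟨specFunctor.obj (op A.obj)⟩
  map f := Quiver.Hom.op ⟨specFunctor.map f.hom.op,
    (preClosedImage_iff_saturated f.hom).1 f.property⟩
  map_id A := congrArg Quiver.Hom.op (WideSubcategory.hom_ext _ (specFunctor.map_id (op A.obj)))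
  map_comp f g := congrArg Quiver.Hom.op
    (WideSubcategory.hom_ext _ (specFunctor.map_comp g.hom.op f.hom.op))

/-- The duality between skew Boolean spaces with saturated morphisms and right-handed algebras
with homomorphisms whose image generates a pre-closed ideal. -/
noncomputable def saturatedDuality :
    (WideSubcategory saturated.{u})ᵒᵖ ≌ WideSubcategory preClosedImage.{u} :=
  CategoryTheory.Equivalence.mk saturatedSectionFunctor preClosedSpecFunctor
    -- The components are those of the unrestricted duality; they and their inverses are
    -- isomorphisms, so they belong to the wide subcategories, where equality of arrows is tested in
    -- the ambient category and naturality is inherited.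
    (NatIso.ofComponents
      (fun p => (WideSubcategory.isoMk
        (X := preClosedSpecFunctor.obj (saturatedSectionFunctor.obj p) |>.unop) (Y := p.unop)
        (spaceIso p.unop.obj).symm (saturated_iso_hom _) (saturated_iso_hom (spaceIso _))).op)
      fun φ => Quiver.Hom.unop_inj (WideSubcategory.hom_ext _
        (congrArg Quiver.Hom.unop (specSectionIso.hom.naturality φ.unop.hom.op))))
    (NatIso.ofComponents
      (fun A => WideSubcategory.isoMk
        (X := saturatedSectionFunctor.obj (preClosedSpecFunctor.obj A)) (Y := A)
        (sectionSpecIso.app A.obj).symm (preClosedImage_iso_hom _)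
        (preClosedImage_iso_hom (sectionSpecIso.app _)))
      fun f => WideSubcategory.hom_ext _ (sectionSpecIso.inv.naturality f.hom))

end SkewDuality

theorem mainTheorem11 :
    (∃ e : SkewDuality.SkewBoolSp.{u}ᵒᵖ ≌ SkewDuality.RSkewAlg.{u},
      e.functor = SkewDuality.sectionFunctor.{u} ∧
      e.inverse = SkewDuality.specFunctor.{u}.rightOp) ∧
    (∀ (p q : SkewDuality.SkewBoolSp.{u}) (φ : p ⟶ q),
      SkewDuality.saturated φ ↔
        SkewDuality.preClosedImage (SkewDuality.sectionFunctor.map φ.op)) ∧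
    (∀ (A B : SkewDuality.RSkewAlg.{u}) (f : A ⟶ B),
      SkewDuality.preClosedImage f ↔
        SkewDuality.saturated (SkewDuality.specFunctor.map f.op)) ∧
    (∃ e : (WideSubcategory SkewDuality.saturated.{u})ᵒᵖ ≌
        WideSubcategory SkewDuality.preClosedImage.{u},
      e.functor ⋙ wideSubcategoryInclusion SkewDuality.preClosedImage.{u} =
        (wideSubcategoryInclusion SkewDuality.saturated.{u}).op ⋙
          SkewDuality.sectionFunctor.{u} ∧
      e.inverse ⋙ (wideSubcategoryInclusion SkewDuality.saturated.{u}).op =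
        wideSubcategoryInclusion SkewDuality.preClosedImage.{u} ⋙
          SkewDuality.specFunctor.{u}.rightOp) :=
  -- The functors of both equivalences are the prescribed ones by definition, so all four identities
  -- are definitional.
  ⟨⟨SkewDuality.skewDuality, rfl, rfl⟩,
    fun _ _ => SkewDuality.saturated_iff_preClosedImage,
    fun _ _ => SkewDuality.preClosedImage_iff_saturated,
    ⟨SkewDuality.saturatedDuality, rfl, rfl⟩⟩
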